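/- **Setting.** Two subnetworks $\Sigma_1,\Sigma_2$ with nonempty finite agent sets $\mathcal V_1,\mathcal V_2$, $n_l=|\mathcal V_l|$, play a zero-sum game. $\mathcal X_l\subset\mathbb R^{m_l}$ is the action set of $\Sigma_l$; $\|\cdot\|$ is any norm on $\mathbb R^{m_l}$. Agent $i\in\mathcal V_l$ has a cost $f_{l,i}(x_1,x_2)$; put $f_l=\frac1{n_l}\sum_{i}f_{l,i}$ and assume $f_1+f_2=0$ on $\mathcal X_1\times\mathcal X_2$; $U=f_1$. A Nash equilibrium (NE) is $(x_1^*,x_2^*)\in\mathcal X_1\times\mathcal X_2$ such that $x_1^*$ minimizes $U(\cdot,x_2^*)$ over $\mathcal X_1$ and $x_2^*$ maximizes $U(x_1^*,\cdot)$ over $\mathcal X_2$. **Assumption 1.** $\mathcal X_1,\mathcal X_2$ are compact and convex, and there are open convex sets $O_l\supseteq\mathcal X_l$ such that each $f_{1,i}$ is real-valued, convex in $x_1\in O_1$ for each $x_2\in \mathcal X_2$ and concave in $x_2\in\mathcal X_2$ for each $x_1\in O_1$, and each $f_{2,i}$ is real-valued, convex in $x_2\in O_2$ for each $x_1\in\mathcal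 X_1$ and concave in $x_1\in\mathcal X_1$ for each $x_2\in O_2$. On $\mathcal X_1\times\mathcal X_2$, each $f_{1,i}$ is $L_{1,1}$-Lipschitz in $x_1$ and $L_{1,2}$-Lipschitz in $x_2$, and each $f_{2,i}$ is $L_{2,1}$-Lipschitz in $x_2$ and $L_{2,2}$-Lipschitz in $x_1$. **Assumption 2.** At time $k=0,1,\dots$ the agents of $\Sigma_l$ communicate over a digraph $\mathcal G_l(k)$ on $\mathcal V_l$ with a self-loop at every node, and the two subnetworks over a bipartite digraph $\mathcal G_{12}(k)$ on $\mathcal V_1\cup\mathcal V_2$; $j$ is a neighbor of $i$ if $(j,i)$ is an edge. For each $l$ there is an integer $B_l\ge1$ such that $\bigcup_{t=k}^{k+B_l-1}\mathcal G_l(t)$ is strongly connected for all $k\ge0$, and every agent always has at least one neighbor in the other subnetwork. The weight matrices $W_l(k)=[w_{l,ij}(k)]$ and $W_{12}(k)=[w_{12,ij}(k)]$ satisfy, for some $\eta\in(0,1)$: a weight with index $ij$ is at least $\eta$ if $j$ is a neighbor of $i$ and is $0$ otherwise; $\sum_jw_{l,ij}(k)=\sum_iw_{l,ij}(k)=1$;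 and $\sum_{j\in\mathcal V_{3-l}}w_{12,ij}(k)=1$ for $i\in\mathcal V_l$. **Assumption 3.** For $l=1,2$, $\psi_l$ is continuously differentiable on $\mathcal X_l$ and $\sigma_l$-strongly convex there ($\sigma_l>0$): $\psi_l(y)\ge\psi_l(x)+\langle\nabla\psi_l(x),y-x\rangle+\frac{\sigma_l}2\|x-y\|^2$ for $x,y\in\mathcal X_l$. The Bregman divergence $D_{\psi_l}(x,y)=\psi_l(x)-\psi_l(y)-\langle\nabla\psi_l(y),x-y\rangle$ is convex in $y\in\mathcal X_l$, and $x_k\to x$ in $\mathcal X_l$ implies $D_{\psi_l}(x_k,x)\to0$. **Distributed mirror descent.** Let $\epsilon\in(0,\frac12)$, $\alpha(t)=t^{-(\frac12+\epsilon)}$ for $t\ge1$, and let $\alpha(0)>0$ be arbitrary. Start with any $x_{l,i}(0)\in\mathcal X_l$. For $t=0,1,2,\dots$ put $v_{l,i}(t)=\sum_{j\in\mathcal V_l}w_{l,ij}(t)x_{l,j}(t)$ for $i\in\mathcal V_l$, and $u_{l,i}(t)=\sum_{j\in\mathcal V_l}w_{12,ij}(t)x_{l,j}(t)$ for $i\in\mathcal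 V_{3-l}$; choose any subgradients $g_{1,i}(t)\in\partial_1f_{1,i}(v_{1,i}(t),u_{2,i}(t))$ and $g_{2,i}(t)\in\partial_2f_{2,i}(u_{1,i}(t),v_{2,i}(t))$, of the convex functions $f_{1,i}(\cdot,u_{2,i}(t))$ on $O_1$ and $f_{2,i}(u_{1,i}(t),\cdot)$ on $O_2$; and set $$x_{l,i}(t+1)=\arg\min_{x\in\mathcal X_l}\Big\{\langle g_{l,i}(t),x-v_{l,i}(t)\rangle+\tfrac1{\alpha(t)}D_{\psi_l}(x,v_{l,i}(t))\Big\}.$$ **Corollary 2.** Let Assumptions 1–3 hold, and let $U$ be strictly convex-concave on $\mathcal X_1\times\mathcal X_2$ (strictly convex in $x_1$ for every $x_2$, strictly concave in $x_2$ for every $x_1$). Then every sequence generated by this algorithm is no-regret and converges to the Nash equilibrium, that is: (a) for all $i\in\mathcal V_1$ and $j\in\mathcal V_2$, as $T\to\infty$, $R_1^{(i)}(T)/T\to0$ and $R_2^{(j)}(T)/T\to0$, where $$R_1^{(i)}(T)=\sum_{t=1}^Tf_1(x_{1,i}(t),u_{2,i}(t))-\min_{x_1\in\mathcal X_1}\sum_{t=1}^Tf_1(x_1,u_{2,i}(t)),$$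 $$R_2^{(j)}(T)=\sum_{t=1}^Tf_2(u_{1,j}(t),x_{2,j}(t))-\min_{x_2\in\mathcal X_2}\sum_{t=1}^Tf_2(u_{1,j}(t),x_2);$$ (b) there is a unique NE $(x_1^*,x_2^*)$, and $\lim_{t\to\infty}x_{1,i}(t)=x_1^*$ and $\lim_{t\to\infty}x_{2,j}(t)=x_2^*$ for all $i\in\mathcal V_1$, $j\in\mathcal V_2$. -/

import Mathlib

open Filter Topology

noncomputable section

namespace SubnetGame

/-! Communication networks -/

/-- Uniform joint strong connectivity of a sequence of digraphs (`Adj j i`: agent `i` receives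
information from agent `j`): for some `B > 0`, the union of any `B` consecutive graphs is strongly
connected. -/
def UniformlyJointlyStronglyConnected {V : Type*} (G : ℕ → Digraph V) : Prop :=
  ∃ B : ℕ, 0 < B ∧ ∀ (k : ℕ) (i j : V),
    Relation.ReflTransGen (fun a b => ∃ t, k ≤ t ∧ t < k + B ∧ (G t).Adj a b) i j

/-- The weight rule with bound `η`: `w i j ≥ η` if `j` is an (in-)neighbor of `i`, and `w i j = 0`
otherwise. -/
def WeightRule {V : Type*} (η : ℝ) (G : Digraph V) (W : Matrix V V ℝ) : Prop :=
  ∀ i j, (G.Adj j i → η ≤ W i j) ∧ (¬ G.Adj j i → W i j = 0)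

/-- The communication structure: a time-varying weighted digraph within each of the two
subnetworks and a time-varying weighted digraph between them. -/
structure Network (V₁ V₂ : Type*) where
  G₁ : ℕ → Digraph V₁
  G₂ : ℕ → Digraph V₂
  G₁₂ : ℕ → Digraph (V₁ ⊕ V₂)
  W₁ : ℕ → Matrix V₁ V₁ ℝ
  W₂ : ℕ → Matrix V₂ V₂ ℝ
  W₁₂ : ℕ → Matrix (V₁ ⊕ V₂) (V₁ ⊕ V₂) ℝ

/-- The assumptions on the communication network. -/
structure Network.Admissible {V₁ V₂ : Type*} [Fintype V₁] [Fintype V₂]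
    (N : Network V₁ V₂) : Prop where
  /-- each agent has access to its own estimate -/
  self_loop₁ : ∀ k i, (N.G₁ k).Adj i i
  self_loop₂ : ∀ k i, (N.G₂ k).Adj i i
  connected₁ : UniformlyJointlyStronglyConnected N.G₁
  connected₂ : UniformlyJointlyStronglyConnected N.G₂
  /-- the graphs between the subnetworks are bipartite -/
  bipartite₁ : ∀ k (i j : V₁), ¬ (N.G₁₂ k).Adj (Sum.inl i) (Sum.inl j)
  bipartite₂ : ∀ k (i j : V₂), ¬ (N.G₁₂ k).Adj (Sum.inr i) (Sum.inr j)
  /-- every agent has a neighbor in the other subnetwork -/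
  neighbor₁ : ∀ k (i : V₁), ∃ j : V₂, (N.G₁₂ k).Adj (Sum.inr j) (Sum.inl i)
  neighbor₂ : ∀ k (i : V₂), ∃ j : V₁, (N.G₁₂ k).Adj (Sum.inl j) (Sum.inr i)
  weights : ∃ η : ℝ, 0 < η ∧ η < 1 ∧ ∀ k, WeightRule η (N.G₁ k) (N.W₁ k) ∧
    WeightRule η (N.G₂ k) (N.W₂ k) ∧ WeightRule η (N.G₁₂ k) (N.W₁₂ k)
  row_sum₁ : ∀ k i, ∑ j, N.W₁ k i j = 1
  col_sum₁ : ∀ k j, ∑ i, N.W₁ k i j = 1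
  row_sum₂ : ∀ k i, ∑ j, N.W₂ k i j = 1
  col_sum₂ : ∀ k j, ∑ i, N.W₂ k i j = 1
  row_sum₁₂ : ∀ k (i : V₁), ∑ j : V₂, N.W₁₂ k (Sum.inl i) (Sum.inr j) = 1
  row_sum₂₁ : ∀ k (i : V₂), ∑ j : V₁, N.W₁₂ k (Sum.inr i) (Sum.inl j) = 1

/-! The game -/

/-- The data of a subnetwork game: action sets `X₁`, `X₂`, contained in the sets `O₁`, `O₂` on
which the costs are defined in the agent's own action, and the agents' costs. -/
structure Game (V₁ V₂ E₁ E₂ : Type*) where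
  X₁ : Set E₁
  X₂ : Set E₂
  O₁ : Set E₁
  O₂ : Set E₂
  f₁ : V₁ → E₁ → E₂ → ℝ
  f₂ : V₂ → E₁ → E₂ → ℝ

section Game

variable {V₁ V₂ E₁ E₂ : Type*} [Fintype V₁] [Fintype V₂]

/-- The global cost of the first subnetwork; this is also the function `U`. -/
def Game.cost₁ (Γ : Game V₁ V₂ E₁ E₂) (x₁ : E₁) (x₂ : E₂) : ℝ :=
  (1 / (Fintype.card V₁ : ℝ)) * ∑ i, Γ.f₁ i x₁ x₂

/-- The global cost of the second subnetwork. -/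
def Game.cost₂ (Γ : Game V₁ V₂ E₁ E₂) (x₁ : E₁) (x₂ : E₂) : ℝ :=
  (1 / (Fintype.card V₂ : ℝ)) * ∑ i, Γ.f₂ i x₁ x₂

/-- The game is zero-sum. -/
def Game.ZeroSum (Γ : Game V₁ V₂ E₁ E₂) : Prop :=
  ∀ x₁ ∈ Γ.X₁, ∀ x₂ ∈ Γ.X₂, Γ.cost₁ x₁ x₂ + Γ.cost₂ x₁ x₂ = 0

/-- Nash equilibria of the zero-sum game with `U = cost₁`. -/
structure Game.IsNash (Γ : Game V₁ V₂ E₁ E₂) (x₁ : E₁) (x₂ : E₂) : Prop where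
  mem₁ : x₁ ∈ Γ.X₁
  mem₂ : x₂ ∈ Γ.X₂
  isMin : IsMinOn (fun y => Γ.cost₁ y x₂) Γ.X₁ x₁
  isMax : IsMaxOn (fun y => Γ.cost₁ x₁ y) Γ.X₂ x₂

variable [NormedAddCommGroup E₁] [NormedSpace ℝ E₁] [NormedAddCommGroup E₂] [NormedSpace ℝ E₂]

/-- The assumptions on the action sets and the costs. The Lipschitz conditions are on the action
sets only; convexity in an agent's own action holds on an open neighborhood of the action set, on
which its subgradients are taken. -/
structure Game.Admissible (Γ : Game V₁ V₂ E₁ E₂) (L₁₁ L₁₂ L₂₁ L₂₂ : ℝ) : Prop where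
  compact₁ : IsCompact Γ.X₁
  compact₂ : IsCompact Γ.X₂
  convex₁ : Convex ℝ Γ.X₁
  convex₂ : Convex ℝ Γ.X₂
  isOpen₁ : IsOpen Γ.O₁
  isOpen₂ : IsOpen Γ.O₂
  subset₁ : Γ.X₁ ⊆ Γ.O₁
  subset₂ : Γ.X₂ ⊆ Γ.O₂
  /-- `f₁ i` is convex-concave -/
  convexOn₁ : ∀ i, ∀ x₂ ∈ Γ.X₂, ConvexOn ℝ Γ.O₁ (fun x₁ => Γ.f₁ i x₁ x₂)
  concaveOn₁ : ∀ i, ∀ x₁ ∈ Γ.O₁, ConcaveOn ℝ Γ.X₂ (fun x₂ => Γ.f₁ i x₁ x₂)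
  /-- `f₂ i` is concave-convex -/
  convexOn₂ : ∀ i, ∀ x₁ ∈ Γ.X₁, ConvexOn ℝ Γ.O₂ (fun x₂ => Γ.f₂ i x₁ x₂)
  concaveOn₂ : ∀ i, ∀ x₂ ∈ Γ.O₂, ConcaveOn ℝ Γ.X₁ (fun x₁ => Γ.f₂ i x₁ x₂)
  lip₁₁ : ∀ i, ∀ x₂ ∈ Γ.X₂, ∀ x₁ ∈ Γ.X₁, ∀ x₁' ∈ Γ.X₁,
    |Γ.f₁ i x₁ x₂ - Γ.f₁ i x₁' x₂| ≤ L₁₁ * ‖x₁ - x₁'‖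
  lip₁₂ : ∀ i, ∀ x₁ ∈ Γ.X₁, ∀ x₂ ∈ Γ.X₂, ∀ x₂' ∈ Γ.X₂,
    |Γ.f₁ i x₁ x₂ - Γ.f₁ i x₁ x₂'| ≤ L₁₂ * ‖x₂ - x₂'‖
  lip₂₁ : ∀ i, ∀ x₁ ∈ Γ.X₁, ∀ x₂ ∈ Γ.X₂, ∀ x₂' ∈ Γ.X₂,
    |Γ.f₂ i x₁ x₂ - Γ.f₂ i x₁ x₂'| ≤ L₂₁ * ‖x₂ - x₂'‖
  lip₂₂ : ∀ i, ∀ x₂ ∈ Γ.X₂, ∀ x₁ ∈ Γ.X₁, ∀ x₁' ∈ Γ.X₁,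
    |Γ.f₂ i x₁ x₂ - Γ.f₂ i x₁' x₂| ≤ L₂₂ * ‖x₁ - x₁'‖

/-- `U` is strictly convex-concave on `X₁ × X₂`. -/
def Game.StrictlyConvexConcave (Γ : Game V₁ V₂ E₁ E₂) : Prop :=
  (∀ x₂ ∈ Γ.X₂, StrictConvexOn ℝ Γ.X₁ (fun x₁ => Γ.cost₁ x₁ x₂)) ∧
  (∀ x₁ ∈ Γ.X₁, StrictConcaveOn ℝ Γ.X₂ (fun x₂ => Γ.cost₁ x₁ x₂))

end Game

/-! Regularizers and Bregman divergences -/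

section Bregman

variable {E : Type*} [NormedAddCommGroup E] [NormedSpace ℝ E]

/-- The Bregman divergence on `X`. For a convex set `X` and `x y ∈ X`, the value of the derivative
within `X` at `y` in the direction `x - y` does not depend on the choice of that derivative. -/
def bregman (X : Set E) (ψ : E → ℝ) (x y : E) : ℝ :=
  ψ x - ψ y - fderivWithin ℝ ψ X y (x - y)

/-- `ψ` is continuously differentiable and `σ`-strongly convex on `X`. -/
structure IsRegularizer (X : Set E) (ψ : E → ℝ) (σ : ℝ) : Prop where
  pos : 0 < σ
  contDiffOn : ContDiffOn ℝ 1 ψ X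
  strong_convex : ∀ x ∈ X, ∀ y ∈ X,
    ψ x + fderivWithin ℝ ψ X x (y - x) + σ / 2 * ‖x - y‖ ^ 2 ≤ ψ y

/-- The divergence is convex in its second argument and satisfies the reciprocity condition. -/
structure BregmanAdmissible (X : Set E) (ψ : E → ℝ) : Prop where
  convex_snd : ∀ x ∈ X, ConvexOn ℝ X (fun y => bregman X ψ x y)
  reciprocity : ∀ (s : ℕ → E) (x : E), (∀ k, s k ∈ X) → x ∈ X → Tendsto s atTop (𝓝 x) →
    Tendsto (fun k => bregman X ψ (s k) x) atTop (𝓝 0)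

/-- The subdifferential at `x` of a function with domain `O`. -/
def subdifferential (O : Set E) (f : E → ℝ) (x : E) : Set (E →L[ℝ] ℝ) :=
  {g | ∀ y ∈ O, f x + g (y - x) ≤ f y}

/-- `y` is a minimizer over `X` of the mirror descent objective with subgradient `g`, base point
`v` and step-size `a`. -/
def IsMirrorStep (X : Set E) (ψ : E → ℝ) (a : ℝ) (g : E →L[ℝ] ℝ) (v y : E) : Prop :=
  y ∈ X ∧ IsMinOn (fun x => g (x - v) + (1 / a) * bregman X ψ x v) X y

end Bregman

/-! The algorithm -/

section Algorithm

variable {V₁ V₂ E₁ E₂ : Type*} [Fintype V₁] [Fintype V₂]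
  [NormedAddCommGroup E₁] [NormedSpace ℝ E₁] [NormedAddCommGroup E₂] [NormedSpace ℝ E₂]

/-- The weighted averages `v_{1,i}(t)` (weights of non-neighbors vanish, so that the sums may run
over all agents). -/
def avg₁ (N : Network V₁ V₂) (x₁ : ℕ → V₁ → E₁) (t : ℕ) (i : V₁) : E₁ :=
  ∑ j, N.W₁ t i j • x₁ t j

/-- The weighted averages `v_{2,i}(t)`. -/
def avg₂ (N : Network V₁ V₂) (x₂ : ℕ → V₂ → E₂) (t : ℕ) (i : V₂) : E₂ :=
  ∑ j, N.W₂ t i j • x₂ t j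

/-- `u_{2,i}(t)`: the estimate, by agent `i` of the first subnetwork, of the action of the second
subnetwork. -/
def est₂ (N : Network V₁ V₂) (x₂ : ℕ → V₂ → E₂) (t : ℕ) (i : V₁) : E₂ :=
  ∑ j : V₂, N.W₁₂ t (Sum.inl i) (Sum.inr j) • x₂ t j

/-- `u_{1,i}(t)`: the estimate, by agent `i` of the second subnetwork, of the action of the first
subnetwork. -/
def est₁ (N : Network V₁ V₂) (x₁ : ℕ → V₁ → E₁) (t : ℕ) (i : V₂) : E₁ :=
  ∑ j : V₁, N.W₁₂ t (Sum.inr i) (Sum.inl j) • x₁ t j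

/-- The sequences `x₁`, `x₂` are generated by the distributed mirror descent algorithm with
step-sizes `α` and received subgradients `g₁`, `g₂`. -/
structure IsMirrorDescent (Γ : Game V₁ V₂ E₁ E₂) (N : Network V₁ V₂) (ψ₁ : E₁ → ℝ) (ψ₂ : E₂ → ℝ)
    (α : ℕ → ℝ) (x₁ : ℕ → V₁ → E₁) (x₂ : ℕ → V₂ → E₂)
    (g₁ : ℕ → V₁ → (E₁ →L[ℝ] ℝ)) (g₂ : ℕ → V₂ → (E₂ →L[ℝ] ℝ)) : Prop where
  init₁ : ∀ i, x₁ 0 i ∈ Γ.X₁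
  init₂ : ∀ i, x₂ 0 i ∈ Γ.X₂
  subgradient₁ : ∀ t i, g₁ t i ∈
    subdifferential Γ.O₁ (fun y => Γ.f₁ i y (est₂ N x₂ t i)) (avg₁ N x₁ t i)
  subgradient₂ : ∀ t i, g₂ t i ∈
    subdifferential Γ.O₂ (fun y => Γ.f₂ i (est₁ N x₁ t i) y) (avg₂ N x₂ t i)
  update₁ : ∀ t i, IsMirrorStep Γ.X₁ ψ₁ (α t) (g₁ t i) (avg₁ N x₁ t i) (x₁ (t + 1) i)
  update₂ : ∀ t i, IsMirrorStep Γ.X₂ ψ₂ (α t) (g₂ t i) (avg₂ N x₂ t i) (x₂ (t + 1) i)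

/-- The regret after `T` steps of the first subnetwork associated with its agent `i`. -/
def regret₁ (Γ : Game V₁ V₂ E₁ E₂) (N : Network V₁ V₂) (x₁ : ℕ → V₁ → E₁) (x₂ : ℕ → V₂ → E₂)
    (i : V₁) (T : ℕ) : ℝ :=
  ∑ t ∈ Finset.Icc 1 T, Γ.cost₁ (x₁ t i) (est₂ N x₂ t i) -
    sInf ((fun y => ∑ t ∈ Finset.Icc 1 T, Γ.cost₁ y (est₂ N x₂ t i)) '' Γ.X₁)

/-- The regret after `T` steps of the second subnetwork associated with its agent `i`. -/
def regret₂ (Γ : Game V₁ V₂ E₁ E₂) (N : Network V₁ V₂) (x₁ : ℕ → V₁ → E₁) (x₂ : ℕ → V₂ → E₂)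
    (i : V₂) (T : ℕ) : ℝ :=
  ∑ t ∈ Finset.Icc 1 T, Γ.cost₂ (est₁ N x₁ t i) (x₂ t i) -
    sInf ((fun y => ∑ t ∈ Finset.Icc 1 T, Γ.cost₂ (est₁ N x₁ t i) y) '' Γ.X₂)

/-- The sequences have no regret, for both subnetworks and all their agents. -/
def NoRegret (Γ : Game V₁ V₂ E₁ E₂) (N : Network V₁ V₂) (x₁ : ℕ → V₁ → E₁)
    (x₂ : ℕ → V₂ → E₂) : Prop :=
  (∀ i, Tendsto (fun T : ℕ => regret₁ Γ N x₁ x₂ i T / (T : ℝ)) atTop (𝓝 0)) ∧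
  (∀ i, Tendsto (fun T : ℕ => regret₂ Γ N x₁ x₂ i T / (T : ℝ)) atTop (𝓝 0))

end Algorithm

end SubnetGame

end

/-! Fix a Nash equilibrium `(z₁, z₂)`, which exists by Sion's theorem, and let `V t` be the sum over
the two subnetworks of the mean Bregman divergence from the equilibrium to the agents' states
(`lyapunov`). Averaging with doubly stochastic weights does not increase it (`sum_bregman_avg_le`),
and a mirror step costs a linear term in the subgradient plus `O(α²)` (`IsMirrorStep.bregman_le`).
The subgradient inequalities, the Lipschitz bounds and the zero-sum identity turn this into `V (t+1)
≤ V t - α t * gap t + O(α t * spread t + α t ^ 2)`, where `gap = U(x₁, z₂) - U(z₁, x₂) ≥ 0` is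
evaluated at one agent of each subnetwork (`IsMirrorDescent.lyapunov_succ_le`).

The errors are summable. `exists_subgradient_bound` bounds the subgradients, so each step moves an
agent by `O(α t)` from its local average; the mixing matrices contract the spread, and `∑ α² < ∞`
then gives `∑ α * spread < ∞` (`IsMixing.summable_spread`). Hence `∑ α * (gap + spread) < ∞`. As `∑
α = ∞`, `gap + spread` is arbitrarily small at arbitrarily late times. By strictness of `U` and
compactness `V` is small at such times (`IsMirrorDescent.lyapunov_small`), and summability of the
errors keeps it small afterwards (`tendsto_zero_of_quasi_fejer`). Strong convexity turns `V → 0`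
into convergence of the states.

No regret is a consequence of convergence: each summand of the regret tends to its equilibrium
value, and Cesàro averaging finishes. -/

namespace SubnetGame

/-! ### Perturbed consensus over time-varying graphs -/

section Consensus

variable {V E : Type*} [Fintype V] [NormedAddCommGroup E] [NormedSpace ℝ E]

/-- The diameter of the set of states of the agents. -/
noncomputable def spread (x : V → E) : ℝ := Metric.diam (Set.range x)

omit [Fintype V] [NormedSpace ℝ E] in
theorem spread_nonneg (x : V → E) : 0 ≤ spread x := Metric.diam_nonneg

theorem norm_sub_le_spread {x : V → E} {a b : E} (ha : a ∈ convexHull ℝ (Set.range x))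
    (hb : b ∈ convexHull ℝ (Set.range x)) : ‖a - b‖ ≤ spread x := by
  rw [← dist_eq_norm, spread, ← convexHull_diam]
  exact Metric.dist_le_diam_of_mem
    (isBounded_convexHull.2 (Set.finite_range x).isBounded) ha hb

omit [Fintype V] in
theorem mem_hull (x : V → E) (i : V) : x i ∈ convexHull ℝ (Set.range x) :=
  subset_convexHull ℝ _ ⟨i, rfl⟩

theorem sum_smul_mem_hull {w : V → ℝ} (hw₀ : ∀ j, 0 ≤ w j) (hw₁ : ∑ j, w j = 1) (x : V → E) :
    ∑ j, w j • x j ∈ convexHull ℝ (Set.range x) :=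
  (convex_convexHull ℝ _).sum_mem (fun j _ => hw₀ j) hw₁ fun j _ => mem_hull x j

omit [Fintype V] [NormedSpace ℝ E] in
theorem spread_le {x : V → E} {c : ℝ} (hc : 0 ≤ c) (h : ∀ i j, ‖x i - x j‖ ≤ c) :
    spread x ≤ c := by
  refine Metric.diam_le_of_forall_dist_le hc ?_
  rintro _ ⟨i, rfl⟩ _ ⟨j, rfl⟩
  rw [dist_eq_norm]
  exact h i j

/-- A row-stochastic matrix with a column bounded below contracts the spread. -/
theorem spread_mul_le {A : Matrix V V ℝ} {δ : ℝ} (hδ₁ : δ < 1) (j₀ : V)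
    (hA₀ : ∀ i j, 0 ≤ A i j) (hA₁ : ∀ i, ∑ j, A i j = 1) (hA : ∀ i, δ ≤ A i j₀) (x : V → E) :
    spread (fun i => ∑ j, A i j • x j) ≤ (1 - δ) * spread x := by
  classical
  have h1 : 0 < 1 - δ := by linarith
  -- Split off weight `δ` on `j₀` from every row: what remains, rescaled, is the stochastic matrix
  -- `p`. The common term `δ • x j₀` cancels in differences, which leaves the factor `1 - δ`.
  set p : V → V → ℝ := fun i j => (1 - δ)⁻¹ * (A i j - if j = j₀ then δ else 0) with hp
  have hp₀ : ∀ i j, 0 ≤ p i j := by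
    intro i j
    refine mul_nonneg (inv_nonneg.2 h1.le) ?_
    split_ifs with h
    · subst h; linarith [hA i]
    · linarith [hA₀ i j]
  have hp₁ : ∀ i, ∑ j, p i j = 1 := by
    intro i
    simp only [hp]
    rw [← Finset.mul_sum, Finset.sum_sub_distrib, hA₁]
    simp [h1.ne']
  have key : ∀ i, ∑ j, A i j • x j = δ • x j₀ + (1 - δ) • ∑ j, p i j • x j := by
    intro i
    have : ∀ j, A i j • x j = (if j = j₀ then δ else 0) • x j + (1 - δ) • p i j • x j := by
      intro j
      rw [smul_smul, ← add_smul]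
      congr 1
      simp only [hp]
      field_simp
      ring
    rw [Finset.sum_congr rfl fun j _ => this j, Finset.sum_add_distrib, Finset.smul_sum]
    simp
  refine spread_le (mul_nonneg h1.le (spread_nonneg x)) fun i k => ?_
  rw [key, key, add_sub_add_left_eq_sub, ← smul_sub, norm_smul, Real.norm_of_nonneg h1.le]
  exact mul_le_mul_of_nonneg_left (norm_sub_le_spread (sum_smul_mem_hull (hp₀ i) (hp₁ i) x)
    (sum_smul_mem_hull (hp₀ k) (hp₁ k) x)) h1.le

/-- The assumptions on the communication within one subnetwork. -/
structure IsMixing (G : ℕ → Digraph V) (W : ℕ → Matrix V V ℝ) : Prop where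
  self_loop : ∀ k i, (G k).Adj i i
  connected : UniformlyJointlyStronglyConnected G
  weights : ∃ η : ℝ, 0 < η ∧ η < 1 ∧ ∀ k, WeightRule η (G k) (W k)
  row_sum : ∀ k i, ∑ j, W k i j = 1
  col_sum : ∀ k j, ∑ i, W k i j = 1

theorem WeightRule.nonneg {V : Type*} {η : ℝ} {G : Digraph V} {W : Matrix V V ℝ}
    (h : WeightRule η G W) (hη : 0 < η) (i j : V) : 0 ≤ W i j := by
  by_cases hG : G.Adj j i
  · exact hη.le.trans ((h i j).1 hG)
  · exact ((h i j).2 hG).ge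

theorem IsMixing.nonneg {G : ℕ → Digraph V} {W : ℕ → Matrix V V ℝ} (h : IsMixing G W)
    (k : ℕ) (i j : V) : 0 ≤ W k i j := by
  obtain ⟨η, hη, -, hw⟩ := h.weights
  exact (hw k).nonneg hη i j

/-- Information spreads over the whole network within `card V * B` steps. -/
theorem reach_eq_univ {G : ℕ → Digraph V} {B : ℕ}
    (hG : ∀ (k : ℕ) (i j : V),
      Relation.ReflTransGen (fun a b => ∃ t, k ≤ t ∧ t < k + B ∧ (G t).Adj a b) i j)
    (t : ℕ) (R : ℕ → Set V) (hmono : Monotone R) (hne : (R 0).Nonempty)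
    (hstep : ∀ s a b, a ∈ R s → (G (t + s)).Adj a b → b ∈ R (s + 1)) :
    R (Fintype.card V * B) = Set.univ := by
  classical
  obtain ⟨j₀, hj₀⟩ := hne
  -- If a window of `B` steps adds no agent, the reached set is closed under all edges of the
  -- window, whose union is strongly connected. So each window adds an agent until all are reached.
  have grow : ∀ s, R (s + B) ⊆ R s → R s = Set.univ := by
    intro s hs
    refine Set.eq_univ_of_forall fun i => ?_
    induction hG (t + s) j₀ i with
    | refl => exact hmono (Nat.zero_le s) hj₀
    | tail _ hab ih =>
      obtain ⟨τ, h1, h2, h3⟩ := hab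
      obtain ⟨r, rfl⟩ := Nat.exists_eq_add_of_le h1
      rw [add_assoc] at h3
      exact hs (hmono (by omega) (hstep (s + r) _ _ (hmono (by omega) ih) h3))
  have main : ∀ m, m < (R (m * B)).ncard ∨ R (m * B) = Set.univ := by
    intro m
    induction m with
    | zero =>
      left
      simpa using (Set.ncard_pos (Set.toFinite _)).2 ⟨j₀, hj₀⟩
    | succ m ih =>
      rw [add_one_mul]
      rcases ih with ih | ih
      · by_cases h : R (m * B + B) ⊆ R (m * B)
        · right
          exact Set.eq_univ_of_univ_subset ((grow _ h).symm.subset.trans (hmono (by omega)))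
        · left
          have : R (m * B) ⊂ R (m * B + B) := ⟨hmono (by omega), h⟩
          have := Set.ncard_lt_ncard this (Set.toFinite _)
          omega
      · right
        exact Set.eq_univ_of_univ_subset (ih.symm.subset.trans (hmono (by omega)))
  rcases main (Fintype.card V) with h | h
  · have := Set.ncard_le_card (R (Fintype.card V * B))
    rw [Nat.card_eq_fintype_card] at this
    omega
  · exact h

open Classical in
/-- The transition matrix from time `t` to time `t + s`. -/
noncomputable def transition (W : ℕ → Matrix V V ℝ) (t : ℕ) : ℕ → Matrix V V ℝ
  | 0 => 1
  | s + 1 => W (t + s) * transition W t s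

theorem transition_nonneg {W : ℕ → Matrix V V ℝ} (hW : ∀ k i j, 0 ≤ W k i j) (t s : ℕ) (i j : V) :
    0 ≤ transition W t s i j := by
  classical
  induction s generalizing i with
  | zero => simp only [transition, Matrix.one_apply]; split_ifs <;> norm_num
  | succ s ih =>
    rw [transition, Matrix.mul_apply]
    exact Finset.sum_nonneg fun k _ => mul_nonneg (hW _ _ _) (ih k)

theorem transition_row_sum {W : ℕ → Matrix V V ℝ} (hW : ∀ k i, ∑ j, W k i j = 1) (t s : ℕ)
    (i : V) : ∑ j, transition W t s i j = 1 := by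
  classical
  induction s generalizing i with
  | zero => simp [transition, Matrix.one_apply]
  | succ s ih =>
    simp only [transition, Matrix.mul_apply]
    rw [Finset.sum_comm]
    simp only [← Finset.mul_sum, ih, mul_one, hW]

theorem transition_succ_smul (W : ℕ → Matrix V V ℝ) (t s : ℕ) (i : V) (x : V → E) :
    ∑ j, transition W t (s + 1) i j • x j =
      ∑ k, W (t + s) i k • ∑ j, transition W t s k j • x j := by
  simp only [transition, Matrix.mul_apply, Finset.sum_smul, Finset.smul_sum, smul_smul]
  rw [Finset.sum_comm]

/-- Along a path of `s` edges from `j₀` the transition weight is at least `η ^ s`, self-loops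
allowing waiting. After `card V * B` steps every agent is reached, so the whole column `j₀` is
bounded below and `spread_mul_le` applies. -/
theorem IsMixing.exists_contraction [Nonempty V] {G : ℕ → Digraph V} {W : ℕ → Matrix V V ℝ}
    (h : IsMixing G W) : ∃ (K : ℕ) (δ : ℝ), 0 < δ ∧ ∀ (t : ℕ) (x : V → E),
      spread (fun i => ∑ j, transition W t K i j • x j) ≤ (1 - δ) * spread x := by
  classical
  obtain ⟨B, hB, hconn⟩ := h.connected
  obtain ⟨η, hη₀, hη₁, hw⟩ := h.weights
  have hn : Fintype.card V ≠ 0 := Fintype.card_ne_zero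
  obtain ⟨j₀⟩ := ‹Nonempty V›
  refine ⟨Fintype.card V * B, η ^ (Fintype.card V * B), by positivity, fun t x => ?_⟩
  refine spread_mul_le
    (pow_lt_one₀ hη₀.le hη₁ (mul_ne_zero hn hB.ne')) j₀
    (transition_nonneg h.nonneg t _) (transition_row_sum h.row_sum t _) ?_ x
  have hstep : ∀ s a b, η ^ s ≤ transition W t s a j₀ → (G (t + s)).Adj a b →
      η ^ (s + 1) ≤ transition W t (s + 1) b j₀ := by
    intro s a b ha hab
    rw [transition, Matrix.mul_apply, pow_succ']
    calc η * η ^ s ≤ W (t + s) b a * transition W t s a j₀ :=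
          mul_le_mul ((hw _ b a).1 hab) ha (by positivity) (h.nonneg _ _ _)
      _ ≤ _ := Finset.single_le_sum
          (f := fun k => W (t + s) b k * transition W t s k j₀)
          (fun k _ => mul_nonneg (h.nonneg _ _ _) (transition_nonneg h.nonneg _ _ _ _))
          (Finset.mem_univ a)
  have := reach_eq_univ hconn t (fun s => {i | η ^ s ≤ transition W t s i j₀})
    (monotone_nat_of_le_succ fun s i hi => hstep s i i hi (h.self_loop _ i))
    ⟨j₀, by simp [transition]⟩ hstep
  exact fun i => (this.symm ▸ Set.mem_univ i : i ∈ {i | _ ≤ transition W t _ i j₀})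

theorem norm_sum_smul_sub_le {w : V → ℝ} (hw₀ : ∀ j, 0 ≤ w j) (hw₁ : ∑ j, w j = 1) {x y : V → E}
    {c : ℝ} (h : ∀ j, ‖x j - y j‖ ≤ c) : ‖∑ j, w j • x j - ∑ j, w j • y j‖ ≤ c := by
  rw [← Finset.sum_sub_distrib]
  calc ‖∑ j, (w j • x j - w j • y j)‖ ≤ ∑ j, w j * c := by
        refine norm_sum_le_of_le _ fun j _ => ?_
        rw [← smul_sub, norm_smul, Real.norm_of_nonneg (hw₀ j)]
        exact mul_le_mul_of_nonneg_left (h j) (hw₀ j)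
    _ = c := by rw [← Finset.sum_mul, hw₁, one_mul]

theorem norm_sub_transition_le {W : ℕ → Matrix V V ℝ} (hW₀ : ∀ k i j, 0 ≤ W k i j)
    (hW₁ : ∀ k i, ∑ j, W k i j = 1) {x : ℕ → V → E} {β : ℕ → ℝ}
    (hx : ∀ t i, ‖x (t + 1) i - ∑ j, W t i j • x t j‖ ≤ β t) (t s : ℕ) (i : V) :
    ‖x (t + s) i - ∑ j, transition W t s i j • x t j‖ ≤ ∑ r ∈ Finset.range s, β (t + r) := by
  classical
  induction s generalizing i with
  | zero => simp [transition, Matrix.one_apply]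
  | succ s ih =>
    rw [transition_succ_smul, Finset.sum_range_succ, add_comm (∑ r ∈ Finset.range s, β (t + r))]
    exact (norm_sub_le_norm_sub_add_norm_sub _ (∑ j, W (t + s) i j • x (t + s) j) _).trans
      (add_le_add (hx (t + s) i) (norm_sum_smul_sub_le (hW₀ _ i) (hW₁ _ i) ih))

/-- Summing over `t < T`, the left side is the partial sum of `b` up to `K` initial terms, so `(1 -
q) * ∑ b` is bounded uniformly in `T`. -/
theorem summable_of_contraction {b c : ℕ → ℝ} {q : ℝ} {K : ℕ} (hq : q < 1) (hb : ∀ t, 0 ≤ b t)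
    (hc : Summable c) (hc₀ : ∀ t, 0 ≤ c t) (h : ∀ t, b (t + K) ≤ q * b t + c t) :
    Summable b := by
  refine summable_of_sum_range_le (c := (∑ t ∈ Finset.range K, b t + ∑' t, c t) / (1 - q)) hb
    fun T => ?_
  rw [le_div_iff₀ (by linarith)]
  have h1 : ∑ t ∈ Finset.range T, b t ≤ ∑ t ∈ Finset.range (K + T), b t :=
    Finset.sum_le_sum_of_subset_of_nonneg (Finset.range_mono (by omega)) fun t _ _ => hb t
  have h2 : ∑ t ∈ Finset.range T, b (K + t) ≤
      q * ∑ t ∈ Finset.range T, b t + ∑ t ∈ Finset.range T, c t := by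
    rw [Finset.mul_sum, ← Finset.sum_add_distrib]
    exact Finset.sum_le_sum fun t _ => by rw [add_comm K]; exact h t
  have h3 := hc.sum_le_tsum (Finset.range T) fun t _ => hc₀ t
  rw [Finset.sum_range_add] at h1
  linarith

/-- Perturbed consensus: the spread is summable against the step-sizes. -/
theorem IsMixing.summable_spread [Nonempty V] {G : ℕ → Digraph V} {W : ℕ → Matrix V V ℝ}
    (h : IsMixing G W) {x : ℕ → V → E} {α : ℕ → ℝ} {C : ℝ} (hα₀ : ∀ t, 0 ≤ α t)
    (hα : AntitoneOn α (Set.Ici 1)) (hα₂ : Summable fun t => α t ^ 2) (hC : 0 ≤ C)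
    (hx : ∀ t i, ‖x (t + 1) i - ∑ j, W t i j • x t j‖ ≤ C * α t) :
    Summable fun t => α t * spread (x t) := by
  obtain ⟨K, δ, hδ, hK⟩ := h.exists_contraction (E := E)
  -- The step-sizes are monotone only from time 1 on, `α 0` being arbitrary.
  rw [← summable_nat_add_iff 1]
  refine summable_of_contraction (K := K) (q := 1 - δ)
    (c := fun t => 2 * C * ∑ r ∈ Finset.range K, α (t + 1 + r) ^ 2) (by linarith)
    (fun t => mul_nonneg (hα₀ _) (spread_nonneg _)) ?_ (fun t => by positivity) ?_
  · refine Summable.mul_left _ (summable_sum fun r _ => ?_)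
    simpa only [add_assoc] using (summable_nat_add_iff (1 + r)).2 hα₂
  · intro t
    rw [add_right_comm]
    set u := t + 1 with hu
    have hS : 0 ≤ ∑ r ∈ Finset.range K, C * α (u + r) :=
      Finset.sum_nonneg fun r _ => mul_nonneg hC (hα₀ _)
    have hsp : spread (x (u + K)) ≤
        (1 - δ) * spread (x u) + 2 * ∑ r ∈ Finset.range K, C * α (u + r) := by
      have h0 := (spread_nonneg _).trans (hK u (x u))
      refine spread_le (by linarith) fun i j => ?_
      have h1 := norm_sub_transition_le h.nonneg h.row_sum hx u K i
      have h2 := norm_sub_transition_le h.nonneg h.row_sum hx u K j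
      have h3 := (norm_sub_le_spread (mem_hull _ i) (mem_hull _ j)).trans (hK u (x u))
      have h4 := norm_sub_le_norm_sub_add_norm_sub (x (u + K) i)
        (∑ l, transition W u K i l • x u l) (x (u + K) j)
      have h5 := norm_sub_le_norm_sub_add_norm_sub (∑ l, transition W u K i l • x u l)
        (∑ l, transition W u K j l • x u l) (x (u + K) j)
      rw [norm_sub_rev] at h2
      linarith
    have hmono : ∀ r ≤ K, α (u + K) ≤ α (u + r) := fun r hr =>
      hα (by simp [hu]; omega) (by simp [hu]; omega) (by omega)
    -- Monotonicity replaces the late step-size by the earlier `α (u + r)`, so the products become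
    -- squares, which are summable.
    have hlast : α (u + K) * ∑ r ∈ Finset.range K, C * α (u + r) ≤
        C * ∑ r ∈ Finset.range K, α (u + r) ^ 2 := by
      rw [Finset.mul_sum, Finset.mul_sum]
      refine Finset.sum_le_sum fun r hr => ?_
      have := mul_le_mul_of_nonneg_right (hmono r (Finset.mem_range.1 hr).le)
        (mul_nonneg hC (hα₀ (u + r)))
      nlinarith
    have h0 := (spread_nonneg _).trans (hK u (x u))
    have h6 := mul_le_mul_of_nonneg_left hsp (hα₀ (u + K))
    have h7 := mul_le_mul_of_nonneg_right (hmono 0 (Nat.zero_le _)) h0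
    rw [add_zero] at h7
    linarith

end Consensus

/-! ### One mirror descent step -/

section MirrorStep

variable {E : Type*} [NormedAddCommGroup E] [NormedSpace ℝ E] {X : Set E} {ψ : E → ℝ} {σ : ℝ}

theorem IsRegularizer.hasFDerivWithinAt (h : IsRegularizer X ψ σ) {x : E} (hx : x ∈ X) :
    HasFDerivWithinAt ψ (fderivWithin ℝ ψ X x) X x :=
  (h.contDiffOn.differentiableOn one_ne_zero x hx).hasFDerivWithinAt

theorem IsRegularizer.le_bregman (h : IsRegularizer X ψ σ) {x y : E} (hx : x ∈ X) (hy : y ∈ X) :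
    σ / 2 * ‖x - y‖ ^ 2 ≤ bregman X ψ x y := by
  have := h.strong_convex y hy x hx
  rw [norm_sub_rev] at this
  unfold bregman
  linarith

theorem IsRegularizer.bregman_nonneg (h : IsRegularizer X ψ σ) {x y : E} (hx : x ∈ X)
    (hy : y ∈ X) : 0 ≤ bregman X ψ x y := by
  have := h.pos
  exact le_trans (by positivity) (h.le_bregman hx hy)

theorem bregman_three_point (X : Set E) (ψ : E → ℝ) (x y v : E) :
    bregman X ψ x v - bregman X ψ x y - bregman X ψ y v =
      (fderivWithin ℝ ψ X y - fderivWithin ℝ ψ X v) (x - y) := by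
  have : x - v = (x - y) + (y - v) := by abel
  simp only [bregman, this, map_add, sub_apply]
  ring

/-- First-order condition for a minimum over a convex set, in the direction from `y` to `x`,
multiplied by `a`. -/
theorem IsMirrorStep.optimality {a : ℝ} {g : E →L[ℝ] ℝ} {v x y : E}
    (h : IsMirrorStep X ψ a g v y) (hX : Convex ℝ X) (hψ : IsRegularizer X ψ σ) (ha : 0 < a)
    (hx : x ∈ X) :
    0 ≤ a * g (x - y) + (fderivWithin ℝ ψ X y - fderivWithin ℝ ψ X v) (x - y) := by
  have hd : HasFDerivWithinAt (fun x => g (x - v) + (1 / a) * bregman X ψ x v)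
      (g + (1 / a) • (fderivWithin ℝ ψ X y - fderivWithin ℝ ψ X v)) X y := by
    have h1 : ∀ L : E →L[ℝ] ℝ, HasFDerivWithinAt (fun x => L (x - v)) L X y := fun L => by
      simpa using L.hasFDerivWithinAt (s := X) (x := y)
    exact (h1 g).add ((((hψ.hasFDerivWithinAt h.1).sub_const _).sub (h1 _)).const_mul (1 / a))
  have := h.2.localize.hasFDerivWithinAt_nonneg hd
    (sub_mem_posTangentConeAt_of_segment_subset (hX.segment_subset h.1 hx))
  simp only [add_apply, smul_apply, smul_eq_mul] at this
  have h2 := mul_nonneg ha.le this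
  rwa [mul_add, ← mul_assoc, mul_one_div_cancel ha.ne', one_mul] at h2

/-- Test optimality with `x = v`: the two divergences between `y` and `v` add up to at least `σ * ‖y
- v‖ ^ 2`, against `a * G * ‖y - v‖`. -/
theorem IsMirrorStep.norm_sub_le {a G : ℝ} {g : E →L[ℝ] ℝ} {v y : E}
    (h : IsMirrorStep X ψ a g v y) (hX : Convex ℝ X) (hψ : IsRegularizer X ψ σ) (ha : 0 < a)
    (hv : v ∈ X) (hg : ‖g‖ ≤ G) : ‖y - v‖ ≤ G / σ * a := by
  have h1 := h.optimality hX hψ ha hv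
  have h2 := bregman_three_point X ψ v y v
  have h3 : bregman X ψ v v = 0 := by simp [bregman]
  have h4 := hψ.le_bregman h.1 hv
  have h5 := hψ.le_bregman hv h.1
  rw [norm_sub_rev] at h5
  have h6 : g (v - y) ≤ G * ‖y - v‖ := by
    rw [norm_sub_rev]
    exact (le_abs_self _).trans (g.le_of_opNorm_le hg _)
  have h7 := mul_le_mul_of_nonneg_left h6 ha.le
  have hσ := hψ.pos
  rw [div_mul_eq_mul_div, le_div_iff₀ hσ]
  rcases (norm_nonneg (y - v)).eq_or_lt with h0 | h0
  · rw [← h0, zero_mul]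
    exact mul_nonneg ((norm_nonneg g).trans hg) ha.le
  · refine le_of_mul_le_mul_right ?_ h0
    nlinarith

/-- Optimality and the three-point identity leave the term `-bregman X ψ y v`. Its quadratic lower
bound absorbs `a * g (v - y)` by completing the square, whence the constant `G ^ 2 / (2 * σ)`. -/
theorem IsMirrorStep.bregman_le {a G : ℝ} {g : E →L[ℝ] ℝ} {v x y : E}
    (h : IsMirrorStep X ψ a g v y) (hX : Convex ℝ X) (hψ : IsRegularizer X ψ σ) (ha : 0 < a)
    (hv : v ∈ X) (hx : x ∈ X) (hg : ‖g‖ ≤ G) :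
    bregman X ψ x y ≤ bregman X ψ x v + a * g (x - v) + G ^ 2 / (2 * σ) * a ^ 2 := by
  have h1 := h.optimality hX hψ ha hx
  have h2 := bregman_three_point X ψ x y v
  have h4 := hψ.le_bregman h.1 hv
  have h6 : g (v - y) ≤ G * ‖y - v‖ := by
    rw [norm_sub_rev]
    exact (le_abs_self _).trans (g.le_of_opNorm_le hg _)
  have h7 := mul_le_mul_of_nonneg_left h6 ha.le
  have h8 : g (x - y) = g (x - v) + g (v - y) := by rw [← map_add, sub_add_sub_cancel]
  have hσ := hψ.pos
  have h9 : a * (G * ‖y - v‖) ≤ σ / 2 * ‖y - v‖ ^ 2 + G ^ 2 / (2 * σ) * a ^ 2 := by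
    have : σ / 2 * ‖y - v‖ ^ 2 + G ^ 2 / (2 * σ) * a ^ 2 - a * (G * ‖y - v‖) =
        (σ * ‖y - v‖ - a * G) ^ 2 / (2 * σ) := by
      field_simp
      ring
    have : 0 ≤ (σ * ‖y - v‖ - a * G) ^ 2 / (2 * σ) := by positivity
    linarith
  rw [h8] at h1
  linarith

/-- The divergence from a fixed point is continuous at that point in its second argument. -/
theorem IsRegularizer.tendsto_bregman {ι : Type*} {l : Filter ι} (hψ : IsRegularizer X ψ σ)
    (hX : Convex ℝ X) {s : ι → E} {x : E} (hs : ∀ k, s k ∈ X) (hx : x ∈ X)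
    (h : Tendsto s l (𝓝 x)) : Tendsto (fun k => bregman X ψ x (s k)) l (𝓝 0) := by
  have hc := hψ.contDiffOn x hx
  -- When `X` has empty interior, `fderivWithin` is one choice among several and need not be
  -- continuous. Smoothness provides some derivative `f'` continuous at `x`; the two agree on `x - s
  -- k`, since the segment between these points lies in `X`.
  rw [← zero_add (1 : WithTop ℕ∞),
    contDiffWithinAt_succ_iff_hasFDerivWithinAt' (by simp)] at hc
  obtain ⟨u, hu, -, -, f', hf', hcont⟩ := hc
  rw [Set.insert_eq_of_mem hx] at hu
  have hsX : Tendsto s l (𝓝[X] x) := tendsto_nhdsWithin_iff.2 ⟨h, Eventually.of_forall hs⟩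
  have hsu : ∀ᶠ k in l, s k ∈ u := hsX hu
  have h1 : Tendsto (fun k => f' (s k)) l (𝓝 (f' x)) :=
    hcont.continuousWithinAt.tendsto.comp hsX
  have h2 : Tendsto (fun k => ψ x - ψ (s k) - f' (s k) (x - s k)) l
      (𝓝 (ψ x - ψ x - f' x (x - x))) :=
    (tendsto_const_nhds.sub ((hψ.contDiffOn.continuousOn x hx).tendsto.comp hsX)).sub
      ((isBoundedBilinearMap_apply.continuous.tendsto (f' x, x - x)).comp
        (h1.prodMk_nhds (tendsto_const_nhds.sub h)))
  rw [sub_self, sub_self, map_zero, sub_zero] at h2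
  refine h2.congr' (hsu.mono fun k hk => ?_)
  have := (hψ.hasFDerivWithinAt (hs k)).unique_on (hf' _ hk)
    (mem_tangentConeAt_of_segment_subset (hX.segment_subset (hs k) hx))
  simp only [bregman, this]

end MirrorStep

/-! ### The iteration within one subnetwork -/

section OneSide

variable {V E : Type*} [Fintype V] [NormedAddCommGroup E] [NormedSpace ℝ E] {X : Set E}
  {ψ : E → ℝ} {σ : ℝ}

theorem sum_smul_mem (hX : Convex ℝ X) {w : V → ℝ} (hw₀ : ∀ j, 0 ≤ w j) (hw₁ : ∑ j, w j = 1)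
    {x : V → E} (hx : ∀ j, x j ∈ X) : ∑ j, w j • x j ∈ X :=
  hX.sum_mem (fun j _ => hw₀ j) hw₁ fun j _ => hx j

/-- Jensen's inequality uses the row sums; exchanging the sums uses the column sums. This is where
double stochasticity matters. -/
theorem sum_bregman_avg_le (hD : BregmanAdmissible X ψ) {W : Matrix V V ℝ}
    (hW₀ : ∀ i j, 0 ≤ W i j) (hrow : ∀ i, ∑ j, W i j = 1) (hcol : ∀ j, ∑ i, W i j = 1) {z : E}
    (hz : z ∈ X) {x : V → E} (hx : ∀ j, x j ∈ X) :
    ∑ i, bregman X ψ z (∑ j, W i j • x j) ≤ ∑ j, bregman X ψ z (x j) := by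
  calc ∑ i, bregman X ψ z (∑ j, W i j • x j) ≤ ∑ i, ∑ j, W i j * bregman X ψ z (x j) :=
        Finset.sum_le_sum fun i _ => by
          simpa using (hD.convex_snd z hz).map_sum_le (fun j _ => hW₀ i j) (hrow i)
            (fun j _ => hx j)
    _ = ∑ j, bregman X ψ z (x j) := by
        rw [Finset.sum_comm]
        simp only [← Finset.sum_mul, hcol, one_mul]

/-- A distributed mirror descent iteration of one subnetwork, with subgradients bounded by `G`. -/
structure IsBoundedRun (X : Set E) (ψ : E → ℝ) (W : ℕ → Matrix V V ℝ) (α : ℕ → ℝ)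
    (x : ℕ → V → E) (g : ℕ → V → (E →L[ℝ] ℝ)) (G : ℝ) : Prop where
  mem : ∀ t i, x t i ∈ X
  update : ∀ t i, IsMirrorStep X ψ (α t) (g t i) (∑ j, W t i j • x t j) (x (t + 1) i)
  bound : ∀ t i, ‖g t i‖ ≤ G

variable {N : ℕ → Digraph V} {W : ℕ → Matrix V V ℝ} {α : ℕ → ℝ} {x : ℕ → V → E}
  {g : ℕ → V → (E →L[ℝ] ℝ)} {G : ℝ}

theorem IsBoundedRun.summable_spread [Nonempty V] (h : IsBoundedRun X ψ W α x g G)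
    (hX : Convex ℝ X) (hψ : IsRegularizer X ψ σ) (hW : IsMixing N W) (hα₀ : ∀ t, 0 < α t)
    (hα : AntitoneOn α (Set.Ici 1)) (hα₂ : Summable fun t => α t ^ 2) :
    Summable fun t => α t * spread (x t) := by
  have hG : 0 ≤ G := (norm_nonneg _).trans (h.bound 0 (Classical.arbitrary V))
  refine hW.summable_spread (fun t => (hα₀ t).le) hα hα₂ (div_nonneg hG hψ.pos.le) fun t i => ?_
  exact (h.update t i).norm_sub_le hX hψ (hα₀ t)
    (sum_smul_mem hX (hW.nonneg t i) (hW.row_sum t i) (h.mem t)) (h.bound t i)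

theorem IsBoundedRun.sum_bregman_le (h : IsBoundedRun X ψ W α x g G)
    (hX : Convex ℝ X) (hψ : IsRegularizer X ψ σ) (hD : BregmanAdmissible X ψ)
    (hW : IsMixing N W) (hα₀ : ∀ t, 0 < α t) {z : E} (hz : z ∈ X) (t : ℕ) :
    ∑ i, bregman X ψ z (x (t + 1) i) ≤ ∑ i, bregman X ψ z (x t i) +
      α t * ∑ i, g t i (z - ∑ j, W t i j • x t j) +
      Fintype.card V * (G ^ 2 / (2 * σ)) * α t ^ 2 := by
  have h1 := sum_bregman_avg_le hD (hW.nonneg t) (hW.row_sum t) (hW.col_sum t) hz (h.mem t)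
  have h2 := Finset.sum_le_sum fun i (_ : i ∈ Finset.univ) =>
    (h.update t i).bregman_le hX hψ (hα₀ t)
      (sum_smul_mem hX (hW.nonneg t i) (hW.row_sum t i) (h.mem t)) hz (h.bound t i)
  rw [Finset.sum_add_distrib, Finset.sum_add_distrib, ← Finset.mul_sum, Finset.sum_const,
    nsmul_eq_mul, Finset.card_univ] at h2
  linarith

end OneSide

/-! ### Uniform bound on the subgradients -/

section SubgradientBound

/-- A real-valued concave function on a bounded convex set of a finite-dimensional space is bounded
above, whatever its values on the boundary are. -/
theorem exists_upper_bound_of_concaveOn {F : Type*} [NormedAddCommGroup F] [NormedSpace ℝ F]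
    [FiniteDimensional ℝ F] {Y : Set F} (hY : Bornology.IsBounded Y) {h : F → ℝ}
    (hh : ConcaveOn ℝ Y h) : ∃ M, ∀ u ∈ Y, h u ≤ M := by
  rcases Y.eq_empty_or_nonempty with rfl | hne
  · exact ⟨0, fun u hu => hu.elim⟩
  -- Take a simplex in `Y` with the same affine span. On it `h` is at least its minimum `m` over the
  -- vertices.
  obtain ⟨S, hSY, hspan, hind⟩ := exists_affineIndependent ℝ F Y
  have hfin : S.Finite := finite_set_of_fin_dim_affineIndependent ℝ hind
  have hSne : S.Nonempty := by
    rw [← affineSpan_nonempty ℝ, hspan, affineSpan_nonempty]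
    exact hne
  obtain ⟨m, hm⟩ := (hfin.image h).bddBelow
  have hhull : ∀ w ∈ convexHull ℝ S, m ≤ h w := by
    intro w hw
    obtain ⟨y, hy, hyw⟩ := hh.exists_le_of_mem_convexHull hSY hw
    exact (hm ⟨y, hy, rfl⟩).trans hyw
  have hsub : convexHull ℝ S ⊆ Y := convexHull_min hSY hh.1
  obtain ⟨c', hc'⟩ := (intrinsicInterior_nonempty (convex_convexHull ℝ S)).2 hSne.convexHull
  obtain ⟨c, hc, rfl⟩ := mem_intrinsicInterior.1 hc'
  obtain ⟨r, hr, hball⟩ := Metric.mem_nhds_iff.1 (mem_interior_iff_mem_nhds.1 hc)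
  have hcY : (c : F) ∈ Y := hsub (intrinsicInterior_subset hc')
  obtain ⟨D, hD⟩ := hY.exists_norm_le
  have hD₀ : 0 ≤ D := (norm_nonneg _).trans (hD _ hcY)
  set τ : ℝ := r / (2 * D + 1) with hτ
  have hτ₀ : 0 < τ := by positivity
  have hτr : τ * (2 * D) < r := by
    rw [hτ, div_mul_eq_mul_div, div_lt_iff₀ (by positivity)]
    nlinarith
  refine ⟨((1 + τ) * h c - m) / τ, fun u hu => ?_⟩
  rw [le_div_iff₀ hτ₀]
  -- Continue the segment from `u` to the relative interior point `c` beyond `c`; `τ` is so small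
  -- that `w` stays in the simplex. Since `c` lies between `w` and `u`, concavity bounds `h u`
  -- through `h c` and `m`.
  set w : F := AffineMap.lineMap (c : F) u (-τ) with hw
  have hwspan : w ∈ affineSpan ℝ (convexHull ℝ S) := by
    refine AffineMap.lineMap_mem _ c.2 ?_
    rw [affineSpan_convexHull, hspan]
    exact subset_affineSpan ℝ _ hu
  have hw' : w = (c : F) + τ • ((c : F) - u) := by
    rw [hw, AffineMap.lineMap_apply_module', neg_smul, ← smul_neg, neg_sub, add_comm]
  have hwhull : w ∈ convexHull ℝ S := by
    have : (⟨w, hwspan⟩ : affineSpan ℝ (convexHull ℝ S)) ∈ Metric.ball c r := by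
      change dist w (c : F) < r
      rw [dist_eq_norm, hw', add_sub_cancel_left, norm_smul, Real.norm_of_nonneg hτ₀.le]
      refine lt_of_le_of_lt (mul_le_mul_of_nonneg_left ?_ hτ₀.le) hτr
      linarith [norm_sub_le (c : F) u, hD _ hcY, hD _ hu]
    exact hball this
  have hcw : (1 / (1 + τ)) • w + (τ / (1 + τ)) • u = (c : F) := by
    rw [hw', smul_add, smul_smul, smul_sub, one_div_mul_eq_div, add_assoc, sub_add_cancel,
      ← add_smul, ← add_div, div_self (by positivity), one_smul]
  have := hh.2 (hsub hwhull) hu (by positivity : 0 ≤ 1 / (1 + τ))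
    (by positivity : 0 ≤ τ / (1 + τ)) (by field_simp)
  rw [hcw, smul_eq_mul, smul_eq_mul, div_mul_eq_mul_div, div_mul_eq_mul_div, ← add_div,
    div_le_iff₀ (by positivity)] at this
  linarith [hhull w hwhull]

variable {E F : Type*} [NormedAddCommGroup E] [NormedSpace ℝ E] [FiniteDimensional ℝ E]
  [NormedAddCommGroup F] [NormedSpace ℝ F] [FiniteDimensional ℝ F]

omit [FiniteDimensional ℝ E] in
theorem norm_le_of_forall_le {g : E →L[ℝ] ℝ} {δ c : ℝ} (hδ : 0 < δ)
    (h : ∀ e, ‖e‖ ≤ δ → g e ≤ c) : ‖g‖ ≤ c / δ := by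
  have hc : 0 ≤ c := by simpa using h 0 (by simpa using hδ.le)
  refine g.opNorm_le_bound (by positivity) fun e => ?_
  rcases eq_or_ne e 0 with rfl | he
  · simp
  have he' : 0 < ‖e‖ := norm_pos_iff.2 he
  have key : ∀ e' : E, ‖e'‖ = ‖e‖ → g e' ≤ c / δ * ‖e‖ := by
    intro e' hn
    have := h ((δ / ‖e‖) • e') (by
      rw [norm_smul, Real.norm_of_nonneg (by positivity), hn, div_mul_cancel₀ _ he'.ne'])
    rw [map_smul, smul_eq_mul, div_mul_eq_mul_div, div_le_iff₀ he'] at this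
    rw [div_mul_eq_mul_div, le_div_iff₀ hδ]
    linarith
  rw [Real.norm_eq_abs, abs_le]
  constructor
  · have := key (-e) (norm_neg e)
    rw [map_neg] at this
    linarith
  · exact key e rfl

/-- Subgradients, at points of a compact set `X` and with respect to an open set `O ⊇ X`, of a
convex-concave function are bounded uniformly in the second argument. -/
theorem exists_subgradient_bound {X O : Set E} {Y : Set F} (hXc : IsCompact X) (hX : Convex ℝ X)
    (hO : IsOpen O) (hXO : X ⊆ O) (hYc : IsCompact Y) {f : E → F → ℝ} {L L' : ℝ}
    (hconv : ∀ u ∈ Y, ConvexOn ℝ O fun x => f x u) (hconc : ∀ x ∈ O, ConcaveOn ℝ Y (f x))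
    (hlip : ∀ u ∈ Y, ∀ x ∈ X, ∀ x' ∈ X, |f x u - f x' u| ≤ L * ‖x - x'‖)
    (hlip' : ∀ x ∈ X, ∀ u ∈ Y, ∀ u' ∈ Y, |f x u - f x u'| ≤ L' * ‖u - u'‖) :
    ∃ G, ∀ v ∈ X, ∀ u ∈ Y, ∀ g ∈ subdifferential O (fun y => f y u) v, ‖g‖ ≤ G := by
  rcases X.eq_empty_or_nonempty with rfl | ⟨v₀, hv₀⟩
  · exact ⟨0, fun v hv => hv.elim⟩
  rcases Y.eq_empty_or_nonempty with rfl | ⟨u₀, hu₀⟩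
  · exact ⟨0, fun _ _ u hu => hu.elim⟩
  -- The Lipschitz bounds hold on `X` only and do not control subgradients at its boundary. So
  -- enclose a `δ`-neighborhood of `X` in a polytope inside `O`: there `f` is bounded above by
  -- convexity from its vertices, at each of which concavity gives a bound uniform in `u`. With a
  -- lower bound on `X × Y`, this bounds `g e` for `‖e‖ ≤ δ`.
  obtain ⟨S, hXS, hSO⟩ := hX.exists_subset_interior_convexHull_finset_of_isCompact hXc
    (hO.mem_nhdsSet.2 hXO)
  obtain ⟨δ, hδ, hδS⟩ := hXc.exists_cthickening_subset_open isOpen_interior hXS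
  have hSO' : (S : Set E) ⊆ O := (subset_convexHull ℝ _).trans hSO
  choose! M hM using fun x (hx : x ∈ O) => exists_upper_bound_of_concaveOn hYc.isBounded (hconc x hx)
  obtain ⟨M', hM'⟩ := (S.image M).exists_le
  have hup : ∀ y ∈ convexHull ℝ (S : Set E), ∀ u ∈ Y, f y u ≤ M' := by
    intro y hy u hu
    obtain ⟨s, hs, hle⟩ := (hconv u hu).exists_ge_of_mem_convexHull hSO' hy
    exact hle.trans ((hM s (hSO' hs) u hu).trans (hM' _ (Finset.mem_image_of_mem M hs)))
  obtain ⟨D, hD⟩ := hXc.isBounded.exists_norm_le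
  obtain ⟨D', hD'⟩ := hYc.isBounded.exists_norm_le
  refine ⟨(M' - (f v₀ u₀ - |L| * (2 * D) - |L'| * (2 * D'))) / δ, fun v hv u hu g hg => ?_⟩
  refine norm_le_of_forall_le hδ fun e he => ?_
  have hmem : v + e ∈ convexHull ℝ (S : Set E) :=
    interior_subset (hδS (Metric.mem_cthickening_of_dist_le _ v δ X hv (by simpa using he)))
  have h1 := hg _ (hSO hmem)
  simp only [add_sub_cancel_left] at h1
  have h2 := hup _ hmem u hu
  have h3 : |f v u - f v₀ u| ≤ |L| * (2 * D) :=
    (hlip u hu v hv v₀ hv₀).trans (mul_le_mul (le_abs_self L)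
      (by linarith [norm_sub_le v v₀, hD _ hv, hD _ hv₀]) (norm_nonneg _) (abs_nonneg L))
  have h4 : |f v₀ u - f v₀ u₀| ≤ |L'| * (2 * D') :=
    (hlip' v₀ hv₀ u hu u₀ hu₀).trans (mul_le_mul (le_abs_self L')
      (by linarith [norm_sub_le u u₀, hD' _ hu, hD' _ hu₀]) (norm_nonneg _) (abs_nonneg L'))
  linarith [(abs_le.1 h3).1, (abs_le.1 h4).1]

end SubgradientBound

/-! ### Cost estimates and average regret -/

section Costs

variable {V V' E F : Type*} [Fintype V] [Fintype V'] [NormedAddCommGroup E] [NormedSpace ℝ E]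
  [NormedAddCommGroup F] [NormedSpace ℝ F]

/-- The subgradient inequality summed over the agents of a subnetwork, with the actual arguments
replaced by common ones at the expense of the spreads. -/
theorem sum_subgradient_le {X O : Set E} {Y : Set F} {f : V → E → F → ℝ} {L L' : ℝ}
    (hX : Convex ℝ X) (hXO : X ⊆ O) (hY : Convex ℝ Y)
    (hlip : ∀ i, ∀ u ∈ Y, ∀ x ∈ X, ∀ x' ∈ X, |f i x u - f i x' u| ≤ L * ‖x - x'‖)
    (hlip' : ∀ i, ∀ x ∈ X, ∀ u ∈ Y, ∀ u' ∈ Y, |f i x u - f i x u'| ≤ L' * ‖u - u'‖)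
    {x v : V → E} {y : V' → F} {u : V → F} {p z : E} {q : F} {g : V → (E →L[ℝ] ℝ)}
    (hx : ∀ i, x i ∈ X) (hy : ∀ j, y j ∈ Y) (hz : z ∈ X)
    (hv : ∀ i, v i ∈ convexHull ℝ (Set.range x)) (hu : ∀ i, u i ∈ convexHull ℝ (Set.range y))
    (hp : p ∈ convexHull ℝ (Set.range x)) (hq : q ∈ convexHull ℝ (Set.range y))
    (hg : ∀ i, g i ∈ subdifferential O (fun w => f i w (u i)) (v i)) :
    ∑ i, g i (z - v i) ≤ ∑ i, f i z q - ∑ i, f i p q +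
      Fintype.card V * (|L| * spread x + 2 * |L'| * spread y) := by
  have hxX : convexHull ℝ (Set.range x) ⊆ X := convexHull_min (Set.range_subset_iff.2 hx) hX
  have hyY : convexHull ℝ (Set.range y) ⊆ Y := convexHull_min (Set.range_subset_iff.2 hy) hY
  have key : ∀ i, g i (z - v i) ≤ f i z q - f i p q + (|L| * spread x + 2 * |L'| * spread y) := by
    intro i
    have h1 := hg i z (hXO hz)
    have h2 : |f i z (u i) - f i z q| ≤ |L'| * spread y :=
      (hlip' i z hz _ (hyY (hu i)) _ (hyY hq)).trans (mul_le_mul (le_abs_self _)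
        (norm_sub_le_spread (hu i) hq) (norm_nonneg _) (abs_nonneg _))
    have h3 : |f i (v i) (u i) - f i p (u i)| ≤ |L| * spread x :=
      (hlip i _ (hyY (hu i)) _ (hxX (hv i)) _ (hxX hp)).trans (mul_le_mul (le_abs_self _)
        (norm_sub_le_spread (hv i) hp) (norm_nonneg _) (abs_nonneg _))
    have h4 : |f i p (u i) - f i p q| ≤ |L'| * spread y :=
      (hlip' i p (hxX hp) _ (hyY (hu i)) _ (hyY hq)).trans (mul_le_mul (le_abs_self _)
        (norm_sub_le_spread (hu i) hq) (norm_nonneg _) (abs_nonneg _))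
    simp only at h1
    linarith [(abs_le.1 h2).2, (abs_le.1 h3).1, (abs_le.1 h4).1]
  refine (Finset.sum_le_sum fun i _ => key i).trans_eq ?_
  rw [Finset.sum_add_distrib, Finset.sum_sub_distrib, Finset.sum_const, nsmul_eq_mul,
    Finset.card_univ]

theorem abs_mean_sub_mean_le [Nonempty V] {a b : V → ℝ} {c : ℝ} (h : ∀ i, |a i - b i| ≤ c) :
    |(1 / (Fintype.card V : ℝ)) * ∑ i, a i - (1 / (Fintype.card V : ℝ)) * ∑ i, b i| ≤ c := by
  have hn : (0 : ℝ) < Fintype.card V := Nat.cast_pos.2 Fintype.card_pos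
  rw [← mul_sub, ← Finset.sum_sub_distrib, abs_mul, abs_of_pos (by positivity), one_div_mul_eq_div,
    div_le_iff₀ hn]
  calc |∑ i, (a i - b i)| ≤ ∑ i, |a i - b i| := Finset.abs_sum_le_sum_abs _ _
    _ ≤ ∑ _i : V, c := Finset.sum_le_sum fun i _ => h i
    _ = c * Fintype.card V := by simp [mul_comm]

omit [NormedSpace ℝ E] [NormedSpace ℝ F] in
theorem continuousOn_of_lipschitz {X : Set E} {Y : Set F} {f : E → F → ℝ} {L L' : ℝ}
    (hlip : ∀ u ∈ Y, ∀ x ∈ X, ∀ x' ∈ X, |f x u - f x' u| ≤ L * ‖x - x'‖)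
    (hlip' : ∀ x ∈ X, ∀ u ∈ Y, ∀ u' ∈ Y, |f x u - f x u'| ≤ L' * ‖u - u'‖) :
    ContinuousOn (fun p : E × F => f p.1 p.2) (X ×ˢ Y) := by
  rintro ⟨x, u⟩ ⟨hx, hu⟩
  have h0 : Tendsto (fun p : E × F => L * ‖p.1 - x‖ + L' * ‖p.2 - u‖) (𝓝[X ×ˢ Y] (x, u))
      (𝓝 0) := by
    have : ContinuousAt (fun p : E × F => L * ‖p.1 - x‖ + L' * ‖p.2 - u‖) (x, u) := by fun_prop
    simpa using this.tendsto.mono_left nhdsWithin_le_nhds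
  rw [ContinuousWithinAt, tendsto_iff_norm_sub_tendsto_zero]
  refine squeeze_zero' (Eventually.of_forall fun _ => norm_nonneg _) ?_ h0
  filter_upwards [self_mem_nhdsWithin] with p hp
  have h1 := hlip p.2 hp.2 p.1 hp.1 x hx
  have h2 := hlip' x hx p.2 hp.2 u hu
  rw [Real.norm_eq_abs]
  exact (abs_sub_le _ (f x p.2) _).trans (add_le_add h1 h2)

omit [NormedSpace ℝ E] [NormedSpace ℝ F] in
/-- Along a convergent sequence of actions the average regret vanishes. -/
theorem tendsto_average_regret {X : Set E} {Y : Set F} {f : E → F → ℝ} {L L' : ℝ}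
    (hlip : ∀ u ∈ Y, ∀ x ∈ X, ∀ x' ∈ X, |f x u - f x' u| ≤ L * ‖x - x'‖)
    (hlip' : ∀ x ∈ X, ∀ u ∈ Y, ∀ u' ∈ Y, |f x u - f x u'| ≤ L' * ‖u - u'‖)
    {x : ℕ → E} {u : ℕ → F} {z : E} {w : F} (hx : ∀ t, x t ∈ X) (hu : ∀ t, u t ∈ Y) (hz : z ∈ X)
    (hw : w ∈ Y) (hxz : Tendsto x atTop (𝓝 z)) (huw : Tendsto u atTop (𝓝 w))
    (hmin : IsMinOn (fun y => f y w) X z) :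
    Tendsto (fun T : ℕ => (∑ t ∈ Finset.Icc 1 T, f (x t) (u t) -
      sInf ((fun y => ∑ t ∈ Finset.Icc 1 T, f y (u t)) '' X)) / (T : ℝ)) atTop (𝓝 0) := by
  -- Both terms of the regret are compared with the sum of `f z w`. The term in `L'` is counted
  -- twice: once for the incurred cost, once for the best fixed action. The bound is two-sided, as
  -- the regret may be negative.
  set b : ℕ → ℝ := fun t => L * ‖x t - z‖ + 2 * (L' * ‖u t - w‖) with hb
  have hb₀ : Tendsto b atTop (𝓝 0) := by
    have h1 := (tendsto_iff_norm_sub_tendsto_zero.1 hxz).const_mul L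
    have h2 := ((tendsto_iff_norm_sub_tendsto_zero.1 huw).const_mul L').const_mul 2
    simpa using h1.add h2
  have hces := ((tendsto_add_atTop_iff_nat 1).2 hb₀).cesaro
  have hxu : ∀ t, |f (x t) (u t) - f z w| ≤ L * ‖x t - z‖ + L' * ‖u t - w‖ := fun t =>
    (abs_sub_le _ (f z (u t)) _).trans
      (add_le_add (hlip _ (hu t) _ (hx t) _ hz) (hlip' _ hz _ (hu t) _ hw))
  have hL : ∀ t, 0 ≤ L * ‖x t - z‖ := fun t =>
    (abs_nonneg _).trans (hlip _ (hu t) _ (hx t) _ hz)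
  have hsum : ∀ T, ∑ t ∈ Finset.Icc 1 T, b t = ∑ t ∈ Finset.range T, b (t + 1) := fun T => by
    rw [Finset.range_eq_Ico, Finset.sum_Ico_add' b 0 T 1]
    rfl
  refine squeeze_zero_norm (fun T => ?_) hces
  rw [norm_div, Real.norm_natCast, div_eq_inv_mul, ← hsum]
  refine mul_le_mul_of_nonneg_left ?_ (by positivity)
  have hlow : ∀ y ∈ X, ∑ t ∈ Finset.Icc 1 T, (f z w - L' * ‖u t - w‖) ≤
      ∑ t ∈ Finset.Icc 1 T, f y (u t) := fun y hy => Finset.sum_le_sum fun t _ => by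
    have h1 := hlip' y hy _ (hu t) _ hw
    have h2 : f z w ≤ f y w := hmin hy
    linarith [(abs_le.1 h1).1]
  have hinf₁ : ∑ t ∈ Finset.Icc 1 T, (f z w - L' * ‖u t - w‖) ≤
      sInf ((fun y => ∑ t ∈ Finset.Icc 1 T, f y (u t)) '' X) :=
    le_csInf (Set.Nonempty.image _ ⟨z, hz⟩) (Set.forall_mem_image.2 hlow)
  have hinf₂ : sInf ((fun y => ∑ t ∈ Finset.Icc 1 T, f y (u t)) '' X) ≤
      ∑ t ∈ Finset.Icc 1 T, f z (u t) :=
    csInf_le ⟨_, Set.forall_mem_image.2 hlow⟩ ⟨z, hz, rfl⟩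
  rw [Real.norm_eq_abs, abs_le]
  constructor
  · rw [neg_le_sub_iff_le_add]
    refine hinf₂.trans ?_
    rw [← Finset.sum_add_distrib]
    refine Finset.sum_le_sum fun t _ => ?_
    have h1 := (abs_le.1 (hlip' _ hz _ (hu t) _ hw)).2
    have h2 := (abs_le.1 (hxu t)).1
    simp only [hb]
    linarith
  · rw [sub_le_iff_le_add']
    refine le_trans ?_ (add_le_add_left hinf₁ _)
    rw [← Finset.sum_add_distrib]
    refine Finset.sum_le_sum fun t _ => ?_
    have h2 := (abs_le.1 (hxu t)).2
    simp only [hb]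
    linarith

end Costs

/-! ### A quasi-Fejér convergence criterion -/

section QuasiFejer

/-- Convergence of a sequence with summable perturbations which decreases by a non-summable
amount as long as it is away from zero. -/
theorem tendsto_zero_of_quasi_fejer {v a gap d c : ℕ → ℝ} (hv : ∀ t, 0 ≤ v t)
    (ha : ∀ t, 0 ≤ a t) (ha' : ¬ Summable a) (hgap : ∀ t, 0 ≤ gap t) (hc₀ : ∀ t, 0 ≤ c t)
    (hc : Summable c) (hd : Summable fun t => a t * d t)
    (hstep : ∀ t, v (t + 1) ≤ v t - a t * gap t + c t)
    (hsmall : ∀ ε > 0, ∃ ε' > 0, ∀ t, gap t + d t < ε' → v t < ε) :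
    Tendsto v atTop (𝓝 0) := by
  have hsg : Summable fun t => a t * gap t := by
    refine summable_of_sum_range_le (c := v 0 + ∑' t, c t)
      (fun t => mul_nonneg (ha t) (hgap t)) fun T => ?_
    have h1 : ∑ t ∈ Finset.range T, a t * gap t ≤ v 0 - v T + ∑ t ∈ Finset.range T, c t := by
      induction T with
      | zero => simp
      | succ T ih =>
        rw [Finset.sum_range_succ, Finset.sum_range_succ]
        linarith [hstep T]
    linarith [hv T, hc.sum_le_tsum (Finset.range T) fun t _ => hc₀ t]
  -- Were `gap + d ≥ ε'` from some time on, summability of `a * (gap + d)` would make `a` summable.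
  -- It is not needed that `d` tends to zero.
  have hfreq : ∀ ε' > 0, ∀ T, ∃ t ≥ T, gap t + d t < ε' := by
    intro ε' hε' T
    by_contra! hcon
    refine ha' ((summable_nat_add_iff T).1 ?_)
    refine Summable.of_nonneg_of_le (fun t => ha _) (fun t => ?_)
      (((summable_nat_add_iff T).2 (hsg.add hd)).mul_left ε'⁻¹)
    rw [← mul_add, inv_mul_eq_div, le_div_iff₀ hε']
    exact mul_le_mul_of_nonneg_left (hcon _ (by omega)) (ha _)
  rw [Metric.tendsto_atTop]
  intro ε hε
  obtain ⟨ε', hε', hsm⟩ := hsmall (ε / 2) (by positivity)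
  -- After `T₀` the perturbations total less than `ε / 2`. Once `v < ε / 2` at some `t ≥ T₀`, `v`
  -- remains below `ε`.
  obtain ⟨T₀, hT₀⟩ := ((tendsto_sum_nat_add c).eventually (gt_mem_nhds (half_pos hε))).exists
  obtain ⟨t, htT, ht⟩ := hfreq ε' hε' T₀
  have hvt := hsm t ht
  have hbound : ∀ s, v (t + s) ≤ v t + ∑ r ∈ Finset.range s, c (t + r) := by
    intro s
    induction s with
    | zero => simp
    | succ s ih =>
      rw [Finset.sum_range_succ, ← add_assoc]
      linarith [hstep (t + s), mul_nonneg (ha (t + s)) (hgap (t + s))]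
  have htail : ∀ s, ∑ r ∈ Finset.range s, c (t + r) ≤ ∑' k, c (k + T₀) := by
    intro s
    have h1 : ∑ r ∈ Finset.range s, c (t + r) ≤ ∑ k ∈ Finset.range (t - T₀ + s), c (k + T₀) := by
      rw [Finset.sum_range_add]
      have h2 : ∑ r ∈ Finset.range s, c (t + r) =
          ∑ r ∈ Finset.range s, c (t - T₀ + r + T₀) :=
        Finset.sum_congr rfl fun r _ => by congr 1; omega
      rw [h2]
      linarith [Finset.sum_nonneg fun k (_ : k ∈ Finset.range (t - T₀)) => hc₀ (k + T₀)]
    exact h1.trans (((summable_nat_add_iff T₀).2 hc).sum_le_tsum _ fun k _ => hc₀ _)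
  refine ⟨t, fun n hn => ?_⟩
  obtain ⟨s, rfl⟩ := Nat.exists_eq_add_of_le hn
  rw [Real.dist_0_eq_abs, abs_of_nonneg (hv _)]
  linarith [hbound s, htail s]

end QuasiFejer

/-! ### Averages and estimates as convex combinations -/

section NetworkLemmas

variable {V₁ V₂ E₁ E₂ : Type*} [Fintype V₁] [Fintype V₂]
  [NormedAddCommGroup E₁] [NormedSpace ℝ E₁] [NormedAddCommGroup E₂] [NormedSpace ℝ E₂]
  {N : Network V₁ V₂}

theorem Network.Admissible.isMixing₁ (hN : N.Admissible) : IsMixing N.G₁ N.W₁ where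
  self_loop := hN.self_loop₁
  connected := hN.connected₁
  weights := by
    obtain ⟨η, h0, h1, h⟩ := hN.weights
    exact ⟨η, h0, h1, fun k => (h k).1⟩
  row_sum := hN.row_sum₁
  col_sum := hN.col_sum₁

theorem Network.Admissible.isMixing₂ (hN : N.Admissible) : IsMixing N.G₂ N.W₂ where
  self_loop := hN.self_loop₂
  connected := hN.connected₂
  weights := by
    obtain ⟨η, h0, h1, h⟩ := hN.weights
    exact ⟨η, h0, h1, fun k => (h k).2.1⟩
  row_sum := hN.row_sum₂
  col_sum := hN.col_sum₂

theorem Network.Admissible.nonneg₁₂ (hN : N.Admissible) (k : ℕ) (i j : V₁ ⊕ V₂) :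
    0 ≤ N.W₁₂ k i j := by
  obtain ⟨η, h0, -, h⟩ := hN.weights
  exact (h k).2.2.nonneg h0 i j

theorem Network.Admissible.avg₁_mem_hull (hN : N.Admissible) (x₁ : ℕ → V₁ → E₁) (t : ℕ) (i : V₁) :
    avg₁ N x₁ t i ∈ convexHull ℝ (Set.range (x₁ t)) :=
  sum_smul_mem_hull (hN.isMixing₁.nonneg t i) (hN.row_sum₁ t i) _

theorem Network.Admissible.avg₂_mem_hull (hN : N.Admissible) (x₂ : ℕ → V₂ → E₂) (t : ℕ) (i : V₂) :
    avg₂ N x₂ t i ∈ convexHull ℝ (Set.range (x₂ t)) :=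
  sum_smul_mem_hull (hN.isMixing₂.nonneg t i) (hN.row_sum₂ t i) _

theorem Network.Admissible.est₁_mem_hull (hN : N.Admissible) (x₁ : ℕ → V₁ → E₁) (t : ℕ) (i : V₂) :
    est₁ N x₁ t i ∈ convexHull ℝ (Set.range (x₁ t)) :=
  sum_smul_mem_hull (fun _ => hN.nonneg₁₂ t _ _) (hN.row_sum₂₁ t i) _

theorem Network.Admissible.est₂_mem_hull (hN : N.Admissible) (x₂ : ℕ → V₂ → E₂) (t : ℕ) (i : V₁) :
    est₂ N x₂ t i ∈ convexHull ℝ (Set.range (x₂ t)) :=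
  sum_smul_mem_hull (fun _ => hN.nonneg₁₂ t _ _) (hN.row_sum₁₂ t i) _

/-- Convex combinations of sequences with a common limit have that limit. -/
theorem tendsto_of_mem_hull {V E : Type*} [Fintype V] [NormedAddCommGroup E] [NormedSpace ℝ E]
    {x : ℕ → V → E} {z : E} (hx : ∀ j, Tendsto (fun t => x t j) atTop (𝓝 z)) {v : ℕ → E}
    (hv : ∀ t, v t ∈ convexHull ℝ (Set.range (x t))) : Tendsto v atTop (𝓝 z) := by
  rw [Metric.tendsto_atTop]
  intro ε hε
  obtain ⟨T, hT⟩ := eventually_atTop.1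
    (eventually_all.2 fun j => Metric.tendsto_nhds.1 (hx j) ε hε)
  refine ⟨T, fun t ht => ?_⟩
  have : convexHull ℝ (Set.range (x t)) ⊆ Metric.ball z ε :=
    convexHull_min (Set.range_subset_iff.2 (hT t ht)) (convex_ball z ε)
  exact this (hv t)

end NetworkLemmas

/-! ### Saddle-point inequalities -/

section NashInequalities

variable {V₁ V₂ E₁ E₂ : Type*} [Fintype V₁] {Γ : Game V₁ V₂ E₁ E₂}

theorem Game.IsNash.gap_nonneg {z₁ p : E₁} {z₂ q : E₂} (hz : Γ.IsNash z₁ z₂) (hp : p ∈ Γ.X₁)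
    (hq : q ∈ Γ.X₂) : 0 ≤ Γ.cost₁ p z₂ - Γ.cost₁ z₁ q := by
  have h1 : Γ.cost₁ z₁ z₂ ≤ Γ.cost₁ p z₂ := hz.isMin hp
  have h2 : Γ.cost₁ z₁ q ≤ Γ.cost₁ z₁ z₂ := hz.isMax hq
  linarith

theorem Game.IsNash.isMinOn_cost₂ [Fintype V₂] {z₁ : E₁} {z₂ : E₂} (hz : Γ.IsNash z₁ z₂) (h0 : Γ.ZeroSum) :
    IsMinOn (fun y => Γ.cost₂ z₁ y) Γ.X₂ z₂ := fun y hy => by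
  have h1 : Γ.cost₁ z₁ y ≤ Γ.cost₁ z₁ z₂ := hz.isMax hy
  change Γ.cost₂ z₁ z₂ ≤ Γ.cost₂ z₁ y
  linarith [h0 z₁ hz.mem₁ y hy, h0 z₁ hz.mem₁ z₂ hz.mem₂]

end NashInequalities

/-! ### Existence and uniqueness of the equilibrium -/

section NashEquilibrium

variable {V₁ V₂ E₁ E₂ : Type*} [Fintype V₁] [Fintype V₂]
  [NormedAddCommGroup E₁] [NormedSpace ℝ E₁] [NormedAddCommGroup E₂] [NormedSpace ℝ E₂]
  {Γ : Game V₁ V₂ E₁ E₂} {L₁₁ L₁₂ L₂₁ L₂₂ : ℝ}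

omit [Fintype V₂] in
theorem Game.Admissible.cost₁_lip₁ [Nonempty V₁] (hΓ : Γ.Admissible L₁₁ L₁₂ L₂₁ L₂₂) :
    ∀ u ∈ Γ.X₂, ∀ x ∈ Γ.X₁, ∀ x' ∈ Γ.X₁, |Γ.cost₁ x u - Γ.cost₁ x' u| ≤ L₁₁ * ‖x - x'‖ :=
  fun u hu x hx x' hx' => abs_mean_sub_mean_le fun i => hΓ.lip₁₁ i u hu x hx x' hx'

omit [Fintype V₂] in
theorem Game.Admissible.cost₁_lip₂ [Nonempty V₁] (hΓ : Γ.Admissible L₁₁ L₁₂ L₂₁ L₂₂) :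
    ∀ x ∈ Γ.X₁, ∀ u ∈ Γ.X₂, ∀ u' ∈ Γ.X₂, |Γ.cost₁ x u - Γ.cost₁ x u'| ≤ L₁₂ * ‖u - u'‖ :=
  fun x hx u hu u' hu' => abs_mean_sub_mean_le fun i => hΓ.lip₁₂ i x hx u hu u' hu'

omit [Fintype V₁] in
theorem Game.Admissible.cost₂_lip₁ [Nonempty V₂] (hΓ : Γ.Admissible L₁₁ L₁₂ L₂₁ L₂₂) :
    ∀ x ∈ Γ.X₁, ∀ u ∈ Γ.X₂, ∀ u' ∈ Γ.X₂, |Γ.cost₂ x u - Γ.cost₂ x u'| ≤ L₂₁ * ‖u - u'‖ :=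
  fun x hx u hu u' hu' => abs_mean_sub_mean_le fun i => hΓ.lip₂₁ i x hx u hu u' hu'

omit [Fintype V₁] in
theorem Game.Admissible.cost₂_lip₂ [Nonempty V₂] (hΓ : Γ.Admissible L₁₁ L₁₂ L₂₁ L₂₂) :
    ∀ u ∈ Γ.X₂, ∀ x ∈ Γ.X₁, ∀ x' ∈ Γ.X₁, |Γ.cost₂ x u - Γ.cost₂ x' u| ≤ L₂₂ * ‖x - x'‖ :=
  fun u hu x hx x' hx' => abs_mean_sub_mean_le fun i => hΓ.lip₂₂ i u hu x hx x' hx'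

omit [Fintype V₂] in
theorem Game.Admissible.continuousOn_cost₁ [Nonempty V₁] (hΓ : Γ.Admissible L₁₁ L₁₂ L₂₁ L₂₂) :
    ContinuousOn (fun p : E₁ × E₂ => Γ.cost₁ p.1 p.2) (Γ.X₁ ×ˢ Γ.X₂) :=
  continuousOn_of_lipschitz hΓ.cost₁_lip₁ hΓ.cost₁_lip₂

omit [Fintype V₂] in
theorem Game.Admissible.continuousOn_cost₁_left [Nonempty V₁]
    (hΓ : Γ.Admissible L₁₁ L₁₂ L₂₁ L₂₂) {u : E₂} (hu : u ∈ Γ.X₂) :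
    ContinuousOn (fun x => Γ.cost₁ x u) Γ.X₁ :=
  hΓ.continuousOn_cost₁.comp (f := fun x => (x, u)) (by fun_prop) fun _ hx => ⟨hx, hu⟩

omit [Fintype V₂] in
theorem Game.Admissible.continuousOn_cost₁_right [Nonempty V₁]
    (hΓ : Γ.Admissible L₁₁ L₁₂ L₂₁ L₂₂) {x : E₁} (hx : x ∈ Γ.X₁) :
    ContinuousOn (fun u => Γ.cost₁ x u) Γ.X₂ :=
  hΓ.continuousOn_cost₁.comp (f := fun u => (x, u)) (by fun_prop) fun _ hu => ⟨hx, hu⟩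

omit [Fintype V₂] in
theorem Game.Admissible.exists_isNash [Nonempty V₁] (hΓ : Γ.Admissible L₁₁ L₁₂ L₂₁ L₂₂)
    (hU : Γ.StrictlyConvexConcave) (h₁ : Γ.X₁.Nonempty) (h₂ : Γ.X₂.Nonempty) :
    ∃ z₁ z₂, Γ.IsNash z₁ z₂ := by
  obtain ⟨z₁, hz₁, z₂, hz₂, h⟩ := Sion.exists_isSaddlePointOn (f := Γ.cost₁) h₁ hΓ.convex₁
    hΓ.compact₁ (fun u hu => (hΓ.continuousOn_cost₁_left hu).lowerSemicontinuousOn)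
    (fun u hu => (hU.1 u hu).convexOn.quasiconvexOn) hΓ.convex₂ h₂ hΓ.compact₂
    (fun x hx => (hΓ.continuousOn_cost₁_right hx).upperSemicontinuousOn)
    (fun x hx => (hU.2 x hx).concaveOn.quasiconcaveOn)
  exact ⟨z₁, z₂, hz₁, hz₂, fun x hx => h x hx z₂ hz₂, fun u hu => h z₁ hz₁ u hu⟩

omit [Fintype V₂] in
-- The gap is the sum of the nonnegative losses of the two players against the equilibrium, so both
-- vanish; strictness makes the optimizers unique.
theorem Game.IsNash.eq_of_gap_nonpos {z₁ p : E₁} {z₂ q : E₂} (hz : Γ.IsNash z₁ z₂)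
    (hU : Γ.StrictlyConvexConcave) (hp : p ∈ Γ.X₁) (hq : q ∈ Γ.X₂)
    (h : Γ.cost₁ p z₂ - Γ.cost₁ z₁ q ≤ 0) : p = z₁ ∧ q = z₂ := by
  have h1 : Γ.cost₁ z₁ z₂ ≤ Γ.cost₁ p z₂ := hz.isMin hp
  have h2 : Γ.cost₁ z₁ q ≤ Γ.cost₁ z₁ z₂ := hz.isMax hq
  constructor
  · refine (hU.1 z₂ hz.mem₂).eq_of_isMinOn (fun y hy => ?_) hz.isMin hp hz.mem₁
    have h3 : Γ.cost₁ z₁ z₂ ≤ Γ.cost₁ y z₂ := hz.isMin hy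
    change Γ.cost₁ p z₂ ≤ Γ.cost₁ y z₂
    linarith
  · refine (hU.2 z₁ hz.mem₁).eq_of_isMaxOn (fun y hy => ?_) hz.isMax hq hz.mem₂
    have h3 : Γ.cost₁ z₁ y ≤ Γ.cost₁ z₁ z₂ := hz.isMax hy
    change Γ.cost₁ z₁ y ≤ Γ.cost₁ z₁ q
    linarith

omit [Fintype V₂] in
theorem Game.IsNash.unique {z₁ y₁ : E₁} {z₂ y₂ : E₂} (hz : Γ.IsNash z₁ z₂)
    (hU : Γ.StrictlyConvexConcave) (hy : Γ.IsNash y₁ y₂) : y₁ = z₁ ∧ y₂ = z₂ := by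
  refine hz.eq_of_gap_nonpos hU hy.mem₁ hy.mem₂ ?_
  have h1 : Γ.cost₁ y₁ z₂ ≤ Γ.cost₁ y₁ y₂ := hy.isMax hz.mem₂
  have h2 : Γ.cost₁ y₁ y₂ ≤ Γ.cost₁ z₁ y₂ := hy.isMin hz.mem₁
  linarith

end NashEquilibrium

/-! ### Lyapunov analysis and convergence -/

section Convergence

variable {V₁ V₂ E₁ E₂ : Type*} [Fintype V₁] [Fintype V₂]
  [NormedAddCommGroup E₁] [NormedSpace ℝ E₁]
  [NormedAddCommGroup E₂] [NormedSpace ℝ E₂]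
  {Γ : Game V₁ V₂ E₁ E₂} {N : Network V₁ V₂} {L₁₁ L₁₂ L₂₁ L₂₂ σ₁ σ₂ : ℝ}
  {ψ₁ : E₁ → ℝ} {ψ₂ : E₂ → ℝ} {α : ℕ → ℝ} {x₁ : ℕ → V₁ → E₁} {x₂ : ℕ → V₂ → E₂}
  {g₁ : ℕ → V₁ → (E₁ →L[ℝ] ℝ)} {g₂ : ℕ → V₂ → (E₂ →L[ℝ] ℝ)}

theorem IsMirrorDescent.mem₁ (h : IsMirrorDescent Γ N ψ₁ ψ₂ α x₁ x₂ g₁ g₂) (t : ℕ) (i : V₁) :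
    x₁ t i ∈ Γ.X₁ := by
  cases t with
  | zero => exact h.init₁ i
  | succ t => exact (h.update₁ t i).1

theorem IsMirrorDescent.mem₂ (h : IsMirrorDescent Γ N ψ₁ ψ₂ α x₁ x₂ g₁ g₂) (t : ℕ) (i : V₂) :
    x₂ t i ∈ Γ.X₂ := by
  cases t with
  | zero => exact h.init₂ i
  | succ t => exact (h.update₂ t i).1

theorem IsMirrorDescent.hull_subset₁ (h : IsMirrorDescent Γ N ψ₁ ψ₂ α x₁ x₂ g₁ g₂)
    (hΓ : Γ.Admissible L₁₁ L₁₂ L₂₁ L₂₂) (t : ℕ) : convexHull ℝ (Set.range (x₁ t)) ⊆ Γ.X₁ :=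
  convexHull_min (Set.range_subset_iff.2 (h.mem₁ t)) hΓ.convex₁

theorem IsMirrorDescent.hull_subset₂ (h : IsMirrorDescent Γ N ψ₁ ψ₂ α x₁ x₂ g₁ g₂)
    (hΓ : Γ.Admissible L₁₁ L₁₂ L₂₁ L₂₂) (t : ℕ) : convexHull ℝ (Set.range (x₂ t)) ⊆ Γ.X₂ :=
  convexHull_min (Set.range_subset_iff.2 (h.mem₂ t)) hΓ.convex₂

theorem IsMirrorDescent.exists_isBoundedRun₁ [FiniteDimensional ℝ E₁] [FiniteDimensional ℝ E₂]
    (h : IsMirrorDescent Γ N ψ₁ ψ₂ α x₁ x₂ g₁ g₂)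
    (hΓ : Γ.Admissible L₁₁ L₁₂ L₂₁ L₂₂) (hN : N.Admissible) :
    ∃ G, IsBoundedRun Γ.X₁ ψ₁ N.W₁ α x₁ g₁ G := by
  classical
  choose G hG using fun i => exists_subgradient_bound hΓ.compact₁ hΓ.convex₁ hΓ.isOpen₁ hΓ.subset₁
    hΓ.compact₂ (hΓ.convexOn₁ i) (hΓ.concaveOn₁ i) (hΓ.lip₁₁ i) (hΓ.lip₁₂ i)
  obtain ⟨M, hM⟩ := (Finset.univ.image G).exists_le
  exact ⟨M, h.mem₁, h.update₁, fun t i =>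
    (hG i _ (h.hull_subset₁ hΓ t (hN.avg₁_mem_hull x₁ t i)) _
      (h.hull_subset₂ hΓ t (hN.est₂_mem_hull x₂ t i)) _ (h.subgradient₁ t i)).trans
      (hM _ (Finset.mem_image_of_mem G (Finset.mem_univ i)))⟩

theorem IsMirrorDescent.exists_isBoundedRun₂ [FiniteDimensional ℝ E₁] [FiniteDimensional ℝ E₂]
    (h : IsMirrorDescent Γ N ψ₁ ψ₂ α x₁ x₂ g₁ g₂)
    (hΓ : Γ.Admissible L₁₁ L₁₂ L₂₁ L₂₂) (hN : N.Admissible) :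
    ∃ G, IsBoundedRun Γ.X₂ ψ₂ N.W₂ α x₂ g₂ G := by
  classical
  choose G hG using fun i => exists_subgradient_bound (f := fun y x => Γ.f₂ i x y)
    hΓ.compact₂ hΓ.convex₂ hΓ.isOpen₂ hΓ.subset₂
    hΓ.compact₁ (hΓ.convexOn₂ i) (hΓ.concaveOn₂ i) (hΓ.lip₂₁ i) (hΓ.lip₂₂ i)
  obtain ⟨M, hM⟩ := (Finset.univ.image G).exists_le
  exact ⟨M, h.mem₂, h.update₂, fun t i =>
    (hG i _ (h.hull_subset₂ hΓ t (hN.avg₂_mem_hull x₂ t i)) _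
      (h.hull_subset₁ hΓ t (hN.est₁_mem_hull x₁ t i)) _ (h.subgradient₂ t i)).trans
      (hM _ (Finset.mem_image_of_mem G (Finset.mem_univ i)))⟩

/-- The Lyapunov function: the sum over the subnetworks of the average divergences from `z₁`
and `z₂`. -/
noncomputable def lyapunov (Γ : Game V₁ V₂ E₁ E₂) (ψ₁ : E₁ → ℝ) (ψ₂ : E₂ → ℝ) (z₁ : E₁) (z₂ : E₂)
    (x₁ : V₁ → E₁) (x₂ : V₂ → E₂) : ℝ :=
  (1 / (Fintype.card V₁ : ℝ)) * ∑ i, bregman Γ.X₁ ψ₁ z₁ (x₁ i) +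
    (1 / (Fintype.card V₂ : ℝ)) * ∑ j, bregman Γ.X₂ ψ₂ z₂ (x₂ j)

/-- One step of the algorithm decreases the Lyapunov function up to errors controlled by the
spreads and the squared step-size. Here `p` and `q` are arbitrary agents' actions. -/
theorem IsMirrorDescent.lyapunov_succ_le [Nonempty V₁] [Nonempty V₂]
    (h : IsMirrorDescent Γ N ψ₁ ψ₂ α x₁ x₂ g₁ g₂)
    (hzero : Γ.ZeroSum) (hΓ : Γ.Admissible L₁₁ L₁₂ L₂₁ L₂₂) (hN : N.Admissible)
    (hψ₁ : IsRegularizer Γ.X₁ ψ₁ σ₁) (hψ₂ : IsRegularizer Γ.X₂ ψ₂ σ₂)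
    (hD₁ : BregmanAdmissible Γ.X₁ ψ₁) (hD₂ : BregmanAdmissible Γ.X₂ ψ₂) (hα : ∀ t, 0 < α t)
    {G₁ G₂ : ℝ} (hG₁ : IsBoundedRun Γ.X₁ ψ₁ N.W₁ α x₁ g₁ G₁)
    (hG₂ : IsBoundedRun Γ.X₂ ψ₂ N.W₂ α x₂ g₂ G₂)
    {z₁ : E₁} {z₂ : E₂} (hz₁ : z₁ ∈ Γ.X₁) (hz₂ : z₂ ∈ Γ.X₂) (p : V₁) (q : V₂) (t : ℕ) :
    lyapunov Γ ψ₁ ψ₂ z₁ z₂ (x₁ (t + 1)) (x₂ (t + 1)) ≤ lyapunov Γ ψ₁ ψ₂ z₁ z₂ (x₁ t) (x₂ t) -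
      α t * (Γ.cost₁ (x₁ t p) z₂ - Γ.cost₁ z₁ (x₂ t q)) +
      ((|L₁₁| + 2 * |L₂₂|) * (α t * spread (x₁ t)) + (|L₂₁| + 2 * |L₁₂|) * (α t * spread (x₂ t)) +
        (G₁ ^ 2 / (2 * σ₁) + G₂ ^ 2 / (2 * σ₂)) * α t ^ 2) := by
  have hn₁ : (0 : ℝ) < Fintype.card V₁ := Nat.cast_pos.2 Fintype.card_pos
  have hn₂ : (0 : ℝ) < Fintype.card V₂ := Nat.cast_pos.2 Fintype.card_pos
  have d₁ := hG₁.sum_bregman_le hΓ.convex₁ hψ₁ hD₁ hN.isMixing₁ hα hz₁ t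
  have d₂ := hG₂.sum_bregman_le hΓ.convex₂ hψ₂ hD₂ hN.isMixing₂ hα hz₂ t
  have s₁ := sum_subgradient_le (f := Γ.f₁) hΓ.convex₁ hΓ.subset₁ hΓ.convex₂ hΓ.lip₁₁ hΓ.lip₁₂
    (h.mem₁ t) (h.mem₂ t) hz₁ (hN.avg₁_mem_hull x₁ t) (hN.est₂_mem_hull x₂ t)
    (mem_hull (x₁ t) p) (mem_hull (x₂ t) q) (h.subgradient₁ t)
  have s₂ := sum_subgradient_le (f := fun i y x => Γ.f₂ i x y) hΓ.convex₂ hΓ.subset₂ hΓ.convex₁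
    hΓ.lip₂₁ hΓ.lip₂₂ (h.mem₂ t) (h.mem₁ t) hz₂ (hN.avg₂_mem_hull x₂ t) (hN.est₁_mem_hull x₁ t)
    (mem_hull (x₂ t) q) (mem_hull (x₁ t) p) (h.subgradient₂ t)
  have c₁ : ∀ x u, ∑ i, Γ.f₁ i x u = Fintype.card V₁ * Γ.cost₁ x u := fun x u => by
    rw [Game.cost₁, ← mul_assoc, mul_one_div_cancel hn₁.ne', one_mul]
  have c₂ : ∀ x u, ∑ i, Γ.f₂ i x u = Fintype.card V₂ * Γ.cost₂ x u := fun x u => by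
    rw [Game.cost₂, ← mul_assoc, mul_one_div_cancel hn₂.ne', one_mul]
  rw [c₁, c₁] at s₁
  simp only [c₂] at s₂
  have e₁ := d₁.trans (add_le_add_left (add_le_add_right
    (mul_le_mul_of_nonneg_left s₁ (hα t).le) _) _)
  have e₂ := d₂.trans (add_le_add_left (add_le_add_right
    (mul_le_mul_of_nonneg_left s₂ (hα t).le) _) _)
  have f₁ := mul_le_mul_of_nonneg_left e₁ (one_div_nonneg.2 hn₁.le)
  have f₂ := mul_le_mul_of_nonneg_left e₂ (one_div_nonneg.2 hn₂.le)
  have z₁' := hzero _ (h.mem₁ t p) _ (h.mem₂ t q)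
  have z₂' := hzero _ (h.mem₁ t p) _ hz₂
  have k₁ : ∀ a b c d e : ℝ, 1 / (Fintype.card V₁ : ℝ) * (a + b * (Fintype.card V₁ * c -
      Fintype.card V₁ * d + Fintype.card V₁ * e) + Fintype.card V₁ * (G₁ ^ 2 / (2 * σ₁)) * b ^ 2) =
      1 / (Fintype.card V₁ : ℝ) * a + b * (c - d + e) + G₁ ^ 2 / (2 * σ₁) * b ^ 2 := by
    intro a b c d e
    generalize G₁ ^ 2 / (2 * σ₁) = w
    field_simp
  have k₂ : ∀ a b c d e : ℝ, 1 / (Fintype.card V₂ : ℝ) * (a + b * (Fintype.card V₂ * c -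
      Fintype.card V₂ * d + Fintype.card V₂ * e) + Fintype.card V₂ * (G₂ ^ 2 / (2 * σ₂)) * b ^ 2) =
      1 / (Fintype.card V₂ : ℝ) * a + b * (c - d + e) + G₂ ^ 2 / (2 * σ₂) * b ^ 2 := by
    intro a b c d e
    generalize G₂ ^ 2 / (2 * σ₂) = w
    field_simp
  rw [k₁] at f₁
  rw [k₂] at f₂
  -- After division by the numbers of agents the zero-sum identity applies: the costs at `(x₁ t p,
  -- x₂ t q)` cancel between the subnetworks, and only the gap remains.
  rw [eq_neg_of_add_eq_zero_right z₁', eq_neg_of_add_eq_zero_right z₂'] at f₂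
  unfold lyapunov
  linarith

/-- By compactness: otherwise, along some times, `gap` and spreads tend to 0 while the Lyapunov
function stays above `ε`. A limit point of the states of `p` and `q` has gap at most 0, hence is the
equilibrium; vanishing spreads bring all agents there, and continuity of the divergences gives a
contradiction. -/
theorem IsMirrorDescent.lyapunov_small [Nonempty V₁] (h : IsMirrorDescent Γ N ψ₁ ψ₂ α x₁ x₂ g₁ g₂)
    (hΓ : Γ.Admissible L₁₁ L₁₂ L₂₁ L₂₂) (hU : Γ.StrictlyConvexConcave)
    (hψ₁ : IsRegularizer Γ.X₁ ψ₁ σ₁) (hψ₂ : IsRegularizer Γ.X₂ ψ₂ σ₂)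
    {z₁ : E₁} {z₂ : E₂} (hz : Γ.IsNash z₁ z₂) (p : V₁) (q : V₂) {ε : ℝ} (hε : 0 < ε) :
    ∃ ε' > 0, ∀ t, (Γ.cost₁ (x₁ t p) z₂ - Γ.cost₁ z₁ (x₂ t q)) +
      (spread (x₁ t) + spread (x₂ t)) < ε' → lyapunov Γ ψ₁ ψ₂ z₁ z₂ (x₁ t) (x₂ t) < ε := by
  by_contra! hcon
  choose! τ hτ hτε using fun n : ℕ => hcon (1 / ((n : ℝ) + 1)) (by positivity)
  obtain ⟨⟨a, b⟩, ⟨ha, hb⟩, φ, hφ, hlim⟩ :=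
    (hΓ.compact₁.prod hΓ.compact₂).tendsto_subseq (x := fun n => (x₁ (τ n) p, x₂ (τ n) q))
      fun n => ⟨h.mem₁ _ p, h.mem₂ _ q⟩
  have hgap : ∀ n, 0 ≤ Γ.cost₁ (x₁ (τ n) p) z₂ - Γ.cost₁ z₁ (x₂ (τ n) q) := fun n =>
    hz.gap_nonneg (h.mem₁ _ p) (h.mem₂ _ q)
  have hone : Tendsto (fun n => 1 / ((φ n : ℝ) + 1)) atTop (𝓝 0) :=
    tendsto_one_div_add_atTop_nhds_zero_nat.comp hφ.tendsto_atTop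
  have hlim₁ : Tendsto (fun n => x₁ (τ (φ n)) p) atTop (𝓝 a) :=
    (continuous_fst.tendsto (a, b)).comp hlim
  have hlim₂ : Tendsto (fun n => x₂ (τ (φ n)) q) atTop (𝓝 b) :=
    (continuous_snd.tendsto (a, b)).comp hlim
  have hcost₁ : Tendsto (fun n => Γ.cost₁ (x₁ (τ (φ n)) p) z₂) atTop (𝓝 (Γ.cost₁ a z₂)) :=
    (hΓ.continuousOn_cost₁_left hz.mem₂ a ha).tendsto.comp
      (tendsto_nhdsWithin_iff.2 ⟨hlim₁, Eventually.of_forall fun n => h.mem₁ _ p⟩)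
  have hcost₂ : Tendsto (fun n => Γ.cost₁ z₁ (x₂ (τ (φ n)) q)) atTop (𝓝 (Γ.cost₁ z₁ b)) :=
    (hΓ.continuousOn_cost₁_right hz.mem₁ b hb).tendsto.comp
      (tendsto_nhdsWithin_iff.2 ⟨hlim₂, Eventually.of_forall fun n => h.mem₂ _ q⟩)
  obtain ⟨rfl, rfl⟩ := hz.eq_of_gap_nonpos hU ha hb
    (le_of_tendsto_of_tendsto' (hcost₁.sub hcost₂) hone fun n => by
      linarith [hτ (φ n), spread_nonneg (x₁ (τ (φ n))), spread_nonneg (x₂ (τ (φ n)))])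
  have hall₁ : ∀ i, Tendsto (fun n => x₁ (τ (φ n)) i) atTop (𝓝 a) := fun i => by
    have hd : ∀ n, dist (x₁ (τ (φ n)) p) (x₁ (τ (φ n)) i) ≤ 1 / ((φ n : ℝ) + 1) := fun n => by
      rw [dist_eq_norm]
      linarith [norm_sub_le_spread (mem_hull (x₁ (τ (φ n))) p) (mem_hull _ i), hτ (φ n),
        spread_nonneg (x₂ (τ (φ n))), hgap (φ n)]
    exact hlim₁.congr_dist (squeeze_zero (fun _ => dist_nonneg) hd hone)
  have hall₂ : ∀ j, Tendsto (fun n => x₂ (τ (φ n)) j) atTop (𝓝 b) := fun j => by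
    have hd : ∀ n, dist (x₂ (τ (φ n)) q) (x₂ (τ (φ n)) j) ≤ 1 / ((φ n : ℝ) + 1) := fun n => by
      rw [dist_eq_norm]
      linarith [norm_sub_le_spread (mem_hull (x₂ (τ (φ n))) q) (mem_hull _ j), hτ (φ n),
        spread_nonneg (x₁ (τ (φ n))), hgap (φ n)]
    exact hlim₂.congr_dist (squeeze_zero (fun _ => dist_nonneg) hd hone)
  have hV : Tendsto (fun n => lyapunov Γ ψ₁ ψ₂ a b (x₁ (τ (φ n))) (x₂ (τ (φ n)))) atTop (𝓝 0) := by
    have h1 := (tendsto_finsetSum Finset.univ fun i _ =>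
      hψ₁.tendsto_bregman hΓ.convex₁ (fun n => h.mem₁ (τ (φ n)) i) ha (hall₁ i)).const_mul
      (1 / (Fintype.card V₁ : ℝ))
    have h2 := (tendsto_finsetSum Finset.univ fun j _ =>
      hψ₂.tendsto_bregman hΓ.convex₂ (fun n => h.mem₂ (τ (φ n)) j) hb (hall₂ j)).const_mul
      (1 / (Fintype.card V₂ : ℝ))
    have h3 := h1.add h2
    rw [Finset.sum_const_zero, Finset.sum_const_zero, mul_zero, mul_zero, add_zero] at h3
    exact h3
  exact absurd (ge_of_tendsto' hV fun n => hτε (φ n)) (not_le.2 hε)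

theorem tendsto_of_sum_bregman {V E : Type*} [Fintype V] [NormedAddCommGroup E] [NormedSpace ℝ E]
    {X : Set E} {ψ : E → ℝ} {σ : ℝ} (hψ : IsRegularizer X ψ σ) {x : ℕ → V → E} {z : E}
    (hx : ∀ t i, x t i ∈ X) (hz : z ∈ X)
    (h : Tendsto (fun t => ∑ i, bregman X ψ z (x t i)) atTop (𝓝 0)) (i : V) :
    Tendsto (fun t => x t i) atTop (𝓝 z) := by
  have hσ := hψ.pos
  have hsq : Tendsto (fun t => ‖x t i - z‖ ^ 2) atTop (𝓝 0) := by
    have h0 := h.const_mul (2 / σ)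
    rw [mul_zero] at h0
    refine squeeze_zero (fun _ => by positivity) (fun t => ?_) h0
    have h1 := hψ.le_bregman hz (hx t i)
    have h2 := Finset.single_le_sum (f := fun j => bregman X ψ z (x t j))
      (fun j _ => hψ.bregman_nonneg hz (hx t j)) (Finset.mem_univ i)
    rw [norm_sub_rev, div_mul_eq_mul_div, le_div_iff₀ hσ]
    linarith
  have hsqrt := hsq.sqrt
  simp only [Real.sqrt_sq (norm_nonneg _), Real.sqrt_zero] at hsqrt
  exact tendsto_iff_norm_sub_tendsto_zero.2 hsqrt

theorem IsMirrorDescent.tendsto_nash [Nonempty V₁] [Nonempty V₂] [FiniteDimensional ℝ E₁] [FiniteDimensional ℝ E₂]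
    (h : IsMirrorDescent Γ N ψ₁ ψ₂ α x₁ x₂ g₁ g₂)
    (hzero : Γ.ZeroSum) (hΓ : Γ.Admissible L₁₁ L₁₂ L₂₁ L₂₂) (hN : N.Admissible)
    (hψ₁ : IsRegularizer Γ.X₁ ψ₁ σ₁) (hψ₂ : IsRegularizer Γ.X₂ ψ₂ σ₂)
    (hD₁ : BregmanAdmissible Γ.X₁ ψ₁) (hD₂ : BregmanAdmissible Γ.X₂ ψ₂)
    (hU : Γ.StrictlyConvexConcave) (hα₀ : ∀ t, 0 < α t) (hα : AntitoneOn α (Set.Ici 1))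
    (hα₁ : ¬ Summable α) (hα₂ : Summable fun t => α t ^ 2)
    {z₁ : E₁} {z₂ : E₂} (hz : Γ.IsNash z₁ z₂) :
    (∀ i, Tendsto (fun t => x₁ t i) atTop (𝓝 z₁)) ∧
      (∀ j, Tendsto (fun t => x₂ t j) atTop (𝓝 z₂)) := by
  have hn₁ : (0 : ℝ) < Fintype.card V₁ := Nat.cast_pos.2 Fintype.card_pos
  have hn₂ : (0 : ℝ) < Fintype.card V₂ := Nat.cast_pos.2 Fintype.card_pos
  obtain ⟨G₁, hG₁⟩ := h.exists_isBoundedRun₁ hΓ hN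
  obtain ⟨G₂, hG₂⟩ := h.exists_isBoundedRun₂ hΓ hN
  have hs₁ := hG₁.summable_spread hΓ.convex₁ hψ₁ hN.isMixing₁ hα₀ hα hα₂
  have hs₂ := hG₂.summable_spread hΓ.convex₂ hψ₂ hN.isMixing₂ hα₀ hα hα₂
  have p : V₁ := Classical.arbitrary V₁
  have q : V₂ := Classical.arbitrary V₂
  have hb₁ : ∀ t, 0 ≤ ∑ i, bregman Γ.X₁ ψ₁ z₁ (x₁ t i) := fun t =>
    Finset.sum_nonneg fun i _ => hψ₁.bregman_nonneg hz.mem₁ (h.mem₁ t i)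
  have hb₂ : ∀ t, 0 ≤ ∑ j, bregman Γ.X₂ ψ₂ z₂ (x₂ t j) := fun t =>
    Finset.sum_nonneg fun j _ => hψ₂.bregman_nonneg hz.mem₂ (h.mem₂ t j)
  have hσ₁ := hψ₁.pos
  have hσ₂ := hψ₂.pos
  have hV : Tendsto (fun t => lyapunov Γ ψ₁ ψ₂ z₁ z₂ (x₁ t) (x₂ t)) atTop (𝓝 0) := by
    -- Here `d` is the sum of the two spreads, known only to be summable against `α`.
    refine tendsto_zero_of_quasi_fejer
      (fun t => add_nonneg (mul_nonneg (by positivity) (hb₁ t)) (mul_nonneg (by positivity) (hb₂ t)))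
      (fun t => (hα₀ t).le) hα₁ (fun t => hz.gap_nonneg (h.mem₁ t p) (h.mem₂ t q)) ?_
      (((hs₁.mul_left _).add (hs₂.mul_left _)).add (hα₂.mul_left _)) ?_
      (h.lyapunov_succ_le hzero hΓ hN hψ₁ hψ₂ hD₁ hD₂ hα₀ hG₁ hG₂ hz.mem₁ hz.mem₂ p q)
      (fun ε hε => h.lyapunov_small hΓ hU hψ₁ hψ₂ hz p q hε)
    · intro t
      have h1 := mul_nonneg (hα₀ t).le (spread_nonneg (x₁ t))
      have h2 := mul_nonneg (hα₀ t).le (spread_nonneg (x₂ t))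
      positivity
    · simpa only [mul_add] using hs₁.add hs₂
  have ht₁ : Tendsto (fun t => ∑ i, bregman Γ.X₁ ψ₁ z₁ (x₁ t i)) atTop (𝓝 0) := by
    have h0 := hV.const_mul (Fintype.card V₁ : ℝ)
    rw [mul_zero] at h0
    refine squeeze_zero hb₁ (fun t => ?_) h0
    rw [lyapunov, mul_add, ← mul_assoc, mul_one_div_cancel hn₁.ne', one_mul]
    have := hb₂ t
    exact le_add_of_nonneg_right (by positivity)
  have ht₂ : Tendsto (fun t => ∑ j, bregman Γ.X₂ ψ₂ z₂ (x₂ t j)) atTop (𝓝 0) := by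
    have h0 := hV.const_mul (Fintype.card V₂ : ℝ)
    rw [mul_zero] at h0
    refine squeeze_zero hb₂ (fun t => ?_) h0
    rw [lyapunov, add_comm, mul_add, ← mul_assoc, mul_one_div_cancel hn₂.ne', one_mul]
    have := hb₁ t
    exact le_add_of_nonneg_right (by positivity)
  exact ⟨tendsto_of_sum_bregman hψ₁ h.mem₁ hz.mem₁ ht₁,
    tendsto_of_sum_bregman hψ₂ h.mem₂ hz.mem₂ ht₂⟩

theorem IsMirrorDescent.noRegret_of_tendsto [Nonempty V₁] [Nonempty V₂]
    (h : IsMirrorDescent Γ N ψ₁ ψ₂ α x₁ x₂ g₁ g₂)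
    (hzero : Γ.ZeroSum) (hΓ : Γ.Admissible L₁₁ L₁₂ L₂₁ L₂₂) (hN : N.Admissible)
    {z₁ : E₁} {z₂ : E₂} (hz : Γ.IsNash z₁ z₂) (h₁ : ∀ i, Tendsto (fun t => x₁ t i) atTop (𝓝 z₁))
    (h₂ : ∀ j, Tendsto (fun t => x₂ t j) atTop (𝓝 z₂)) : NoRegret Γ N x₁ x₂ :=
  ⟨fun i => tendsto_average_regret hΓ.cost₁_lip₁ hΓ.cost₁_lip₂ (fun t => h.mem₁ t i)
      (fun t => h.hull_subset₂ hΓ t (hN.est₂_mem_hull x₂ t i)) hz.mem₁ hz.mem₂ (h₁ i)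
      (tendsto_of_mem_hull h₂ fun t => hN.est₂_mem_hull x₂ t i) hz.isMin,
    fun j => tendsto_average_regret (f := fun y x => Γ.cost₂ x y) hΓ.cost₂_lip₁ hΓ.cost₂_lip₂
      (fun t => h.mem₂ t j) (fun t => h.hull_subset₁ hΓ t (hN.est₁_mem_hull x₁ t j)) hz.mem₂
      hz.mem₁ (h₂ j) (tendsto_of_mem_hull h₁ fun t => hN.est₁_mem_hull x₁ t j)
      (hz.isMinOn_cost₂ hzero)⟩

end Convergence

/-! ### The step-sizes: `∑ α = ∞` and `∑ α² < ∞` -/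

section StepSizes

variable {ε : ℝ} {α : ℕ → ℝ}

theorem stepSize_pos (hα₀ : 0 < α 0) (hα : ∀ t : ℕ, 1 ≤ t → α t = (t : ℝ) ^ (-(1 / 2 + ε)))
    (t : ℕ) : 0 < α t := by
  rcases t.eq_zero_or_pos with rfl | ht
  · exact hα₀
  · rw [hα t ht]
    exact Real.rpow_pos_of_pos (Nat.cast_pos.2 ht) _

theorem stepSize_antitoneOn (hε₀ : 0 < ε)
    (hα : ∀ t : ℕ, 1 ≤ t → α t = (t : ℝ) ^ (-(1 / 2 + ε))) : AntitoneOn α (Set.Ici 1) := by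
  intro s hs t ht hst
  rw [Set.mem_Ici] at hs ht
  rw [hα s hs, hα t ht]
  exact Real.rpow_le_rpow_of_nonpos (Nat.cast_pos.2 hs) (Nat.cast_le.2 hst) (by linarith)

theorem not_summable_stepSize (hε₁ : ε < 1 / 2)
    (hα : ∀ t : ℕ, 1 ≤ t → α t = (t : ℝ) ^ (-(1 / 2 + ε))) : ¬ Summable α := by
  intro h
  have h1 : Summable fun t : ℕ => (t : ℝ) ^ (-(1 / 2 + ε)) := by
    -- Index 0 is dropped: there `α` is arbitrary and the real power of 0 is a default value.
    rw [← summable_nat_add_iff 1] at h ⊢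
    exact h.congr fun t => hα _ (by omega)
  rw [Real.summable_nat_rpow] at h1
  linarith

theorem summable_stepSize_sq (hε₀ : 0 < ε)
    (hα : ∀ t : ℕ, 1 ≤ t → α t = (t : ℝ) ^ (-(1 / 2 + ε))) : Summable fun t => α t ^ 2 := by
  have h1 : Summable fun t : ℕ => (t : ℝ) ^ (-(1 / 2 + ε) * 2) := by
    rw [Real.summable_nat_rpow]
    linarith
  rw [← summable_nat_add_iff 1] at h1 ⊢
  refine h1.congr fun t => ?_
  rw [hα _ (by omega), Real.rpow_mul (Nat.cast_nonneg _), Real.rpow_ofNat]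

end StepSizes

end SubnetGame

theorem corollary2
    {V₁ V₂ E₁ E₂ : Type*} [Fintype V₁] [Fintype V₂] [Nonempty V₁] [Nonempty V₂]
    [NormedAddCommGroup E₁] [NormedSpace ℝ E₁] [FiniteDimensional ℝ E₁]
    [NormedAddCommGroup E₂] [NormedSpace ℝ E₂] [FiniteDimensional ℝ E₂]
    (Γ : SubnetGame.Game V₁ V₂ E₁ E₂) (N : SubnetGame.Network V₁ V₂)
    (L₁₁ L₁₂ L₂₁ L₂₂ σ₁ σ₂ : ℝ) (ψ₁ : E₁ → ℝ) (ψ₂ : E₂ → ℝ)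
    (hzero : Γ.ZeroSum)
    (hΓ : Γ.Admissible L₁₁ L₁₂ L₂₁ L₂₂)
    (hN : N.Admissible)
    (hψ₁ : SubnetGame.IsRegularizer Γ.X₁ ψ₁ σ₁)
    (hψ₂ : SubnetGame.IsRegularizer Γ.X₂ ψ₂ σ₂)
    (hD₁ : SubnetGame.BregmanAdmissible Γ.X₁ ψ₁)
    (hD₂ : SubnetGame.BregmanAdmissible Γ.X₂ ψ₂)
    (hU : Γ.StrictlyConvexConcave)
    (ε : ℝ) (hε₀ : 0 < ε) (hε₁ : ε < 1 / 2)
    (α : ℕ → ℝ) (hα₀ : 0 < α 0) (hα : ∀ t : ℕ, 1 ≤ t → α t = (t : ℝ) ^ (-(1 / 2 + ε)))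
    (x₁ : ℕ → V₁ → E₁) (x₂ : ℕ → V₂ → E₂)
    (g₁ : ℕ → V₁ → (E₁ →L[ℝ] ℝ)) (g₂ : ℕ → V₂ → (E₂ →L[ℝ] ℝ))
    (hrun : SubnetGame.IsMirrorDescent Γ N ψ₁ ψ₂ α x₁ x₂ g₁ g₂) :
    SubnetGame.NoRegret Γ N x₁ x₂ ∧
    ∃ x₁s x₂s, Γ.IsNash x₁s x₂s ∧
      (∀ y₁ y₂, Γ.IsNash y₁ y₂ → y₁ = x₁s ∧ y₂ = x₂s) ∧
      (∀ i, Tendsto (fun t => x₁ t i) atTop (𝓝 x₁s)) ∧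
      (∀ j, Tendsto (fun t => x₂ t j) atTop (𝓝 x₂s)) := by
  have hne₁ : Γ.X₁.Nonempty := ⟨_, hrun.init₁ (Classical.arbitrary V₁)⟩
  have hne₂ : Γ.X₂.Nonempty := ⟨_, hrun.init₂ (Classical.arbitrary V₂)⟩
  obtain ⟨z₁, z₂, hz⟩ := hΓ.exists_isNash hU hne₁ hne₂
  obtain ⟨h₁, h₂⟩ := hrun.tendsto_nash hzero hΓ hN hψ₁ hψ₂ hD₁ hD₂ hU
    (SubnetGame.stepSize_pos hα₀ hα) (SubnetGame.stepSize_antitoneOn hε₀ hα)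
    (SubnetGame.not_summable_stepSize hε₁ hα) (SubnetGame.summable_stepSize_sq hε₀ hα) hz
  exact ⟨hrun.noRegret_of_tendsto hzero hΓ hN hz h₁ h₂, z₁, z₂, hz,
    fun y₁ y₂ hy => hz.unique hU hy, h₁, h₂⟩
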